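/- Let $m\ge 2$ be an integer and let $T=(\mathcal V,\mathcal E)$ be the infinite homogeneous tree of order $m+1$ (connected, acyclic, each vertex having exactly $m+1$ neighbours), with graph distance $d$. Fix a doubly-infinite geodesic $g\subset\mathcal V$ and a map $N:g\to\mathbb Z$ with $|N(x)-N(y)|=d(x,y)$ for all $x,y\in g$. Let $\ell(x)=N(x')-d(x,x')$, where $x'$ is the point of $g$ nearest to $x$, and let $\mu$ be the measure on $\mathcal V$ with $\mu(\{x\})=m^{\ell(x)}$. Say that $x$ lies below $y$ if $\ell(x)=\ell(y)-d(x,y)$. The family $\mathcal R$ of Calderón–Zygmund sets consists of all singletons $\{x_0\}$ and of all sets $$\{x\in\mathcal V:\ x\text{ lies below }x_0,\ h/2\le \ell(x_0)-\ell(x)<4h\},\qquad x_0\in\mathcal V,\ h\in\{1,2,3,\dots\}.$$ For $1<p\le\infty$, a $(1,p)$-atom is a function $a:\mathcal V\to\mathbb C$ supported in some $R\in\mathcal R$ with $\|a\|_{L^p(\mu)}\le\mu(R)^{1/p-1}$ and $\int a\,d\mu=0$. The Hardy space $H^{1,p}(\mu)$ is the space of all $g\in L^1(\mu)$ of the form $g=\sum_j\lambda_ja_j$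 with $a_j$ $(1,p)$-atoms, $\lambda_j\in\mathbb C$ and $\sum_j|\lambda_j|<\infty$; $\|g\|_{H^{1,p}}$ is the infimum of $\sum_j|\lambda_j|$ over all such representations. Let $H^1(\mu)=H^{1,\infty}(\mu)$, and let $H^{1,\infty}_{\rm fin}(\mu)$ be the space of finite linear combinations of $(1,\infty)$-atoms. For $1\le q<\infty$, let $BMO_q(\mu)$ be the space of all $f\in L^q_{\rm loc}(\mu)$, modulo constants, such that $$\|f\|_{BMO_q}=\sup_{R\in\mathcal R}\Big(\frac1{\mu(R)}\int_R|f-f_R|^q\,d\mu\Big)^{1/q}<\infty,\qquad f_R=\frac1{\mu(R)}\int_R f\,d\mu .$$ Then there exist a constant $A>0$ and constants $C_p$, $p\in(1,\infty)$, such that: 1. for every $f\in BMO_1(\mu)$ there is a bounded linear functional $L_f$ on $H^1(\mu)$ with $L_f(g)=\int fg\,d\mu$ for all $g\in H^{1,\infty}_{\rm fin}(\mu)$ and $\|L_f\|_{(H^1)^*}\le A\|f\|_{BMO_1}$; 2. for every $p\in(1,\infty)$, $H^{1,p}(\mu)=H^{1,\infty}(\mu)$ and $\|g\|_{H^{1,p}}\le\|g\|_{H^{1,\infty}}\le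 C_p\|g\|_{H^{1,p}}$ for all $g$ in this space; 3. for every $q\in(1,\infty)$, with $p=q'=q/(q-1)$, the space $BMO_q(\mu)$ coincides with $BMO_1(\mu)$ and $$\|f\|_{BMO_1}\le\|f\|_{BMO_q}\le A\,C_p\,\|f\|_{BMO_1}\qquad\text{for all } f\in BMO_q(\mu).$$ -/

import Mathlib

open MeasureTheory Set
open scoped ENNReal NNReal

/-- A homogeneous tree of order `m + 1` with vertex set `V` (a connected acyclic graph in which each
vertex has exactly `m + 1` neighbours), together with a doubly-infinite geodesic and a numbering
`N` of that geodesic by integers. -/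
structure WeightedTree (V : Type*) (m : ℕ) where
  /-- the underlying graph -/
  graph : SimpleGraph V
  isTree : graph.IsTree
  card_neighbors : ∀ v, (graph.neighborSet v).ncard = m + 1
  /-- the doubly-infinite geodesic -/
  geodesic : Set V
  geodesic_connected : (graph.induce geodesic).Connected
  geodesic_neighbors : ∀ v ∈ geodesic, (graph.neighborSet v ∩ geodesic).ncard = 2
  geodesic_path : ∀ u ∈ geodesic, ∀ v ∈ geodesic, ∀ p : graph.Walk u v,
    p.length = graph.dist u v → ∀ w ∈ p.support, w ∈ geodesic
  /-- the numbering of the geodesic -/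
  N : geodesic → ℤ
  abs_N_sub : ∀ x y : geodesic, |N x - N y| = (graph.dist (x : V) (y : V) : ℤ)

namespace WeightedTree

noncomputable section

variable {V : Type*} {m : ℕ}

/-- Each vertex has a nearest point on the geodesic. -/
theorem exists_nearest (T : WeightedTree V m) (x : V) :
    ∃ x' : T.geodesic, ∀ z : T.geodesic, T.graph.dist x x' ≤ T.graph.dist x z := by
  obtain ⟨z₀⟩ := T.geodesic_connected.nonempty
  have h := Function.argmin_le (fun z : T.geodesic => T.graph.dist x z)
  have : Nonempty T.geodesic := ⟨z₀⟩
  exact ⟨Function.argmin (fun z : T.geodesic => T.graph.dist x z), fun z => h z⟩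

/-- The vertex of the geodesic nearest to `x`. -/
def nearest (T : WeightedTree V m) (x : V) : T.geodesic := (T.exists_nearest x).choose

/-- The level function `ℓ(x) = N(x') - d(x, x')`. -/
def level (T : WeightedTree V m) (x : V) : ℤ :=
  T.N (T.nearest x) - (T.graph.dist x (T.nearest x) : ℤ)

/-- `x` lies below `y` (equivalently `y` lies above `x`). -/
def LiesBelow (T : WeightedTree V m) (x y : V) : Prop :=
  T.level x = T.level y - (T.graph.dist x y : ℤ)

/-- The trapezoid with root `x` and parameters `a`, `b`. -/
def trapezoid (T : WeightedTree V m) (x : V) (a b : ℝ) : Set V :=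
  {y | T.LiesBelow y x ∧ a ≤ ((T.level x - T.level y : ℤ) : ℝ) ∧
    ((T.level x - T.level y : ℤ) : ℝ) < b}

/-- The Calderón–Zygmund sets: the single vertices, and the envelopes
`h / 2 ≤ ℓ(x_R) - ℓ(x) < 4 h` of the admissible trapezoids `h ≤ ℓ(x_R) - ℓ(x) < 2 h`. -/
def czSets (T : WeightedTree V m) : Set (Set V) :=
  {R | (∃ x, R = {x}) ∨ ∃ (x : V) (h : ℕ), 0 < h ∧ R = T.trapezoid x ((h : ℝ) / 2) (4 * h)}

/-- The measure giving the vertex `x` the mass `m ^ ℓ(x)`. -/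
def μ [MeasurableSpace V] (T : WeightedTree V m) : Measure V :=
  Measure.count.withDensity fun x => (((m : ℝ≥0) ^ T.level x : ℝ≥0) : ℝ≥0∞)

/-! Finiteness of Calderón–Zygmund sets. -/

theorem finite_dist_eq (T : WeightedTree V m) (x : V) (n : ℕ) :
    {y | T.graph.dist y x = n}.Finite := by
  induction n with
  | zero =>
    refine (Set.finite_singleton x).subset fun y hy => ?_
    exact (T.isTree.1.dist_eq_zero_iff).1 hy
  | succ n ih =>
    refine (ih.biUnion (t := fun z => T.graph.neighborSet z) fun z _ => ?_).subset fun y hy => ?_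
    · exact Set.finite_of_ncard_ne_zero (by rw [T.card_neighbors]; omega)
    · obtain ⟨p, hp⟩ := T.isTree.1.exists_walk_length_eq_dist y x
      cases p with
      | nil => simp at hp; simp at hy
      | @cons _ z _ hadj p =>
        refine Set.mem_biUnion (x := z) ?_ hadj.symm
        have h1 : T.graph.dist z x ≤ p.length := T.graph.dist_le p
        have h2 : T.graph.dist y x ≤ T.graph.dist z x + 1 := by
          obtain ⟨r, hr⟩ := T.isTree.1.exists_walk_length_eq_dist z x
          simpa [hr] using T.graph.dist_le (SimpleGraph.Walk.cons hadj r)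
        simp only [SimpleGraph.Walk.length_cons] at hp
        simp only [Set.mem_ofPred_eq] at hy ⊢
        omega

theorem czSets_finite (T : WeightedTree V m) {R : Set V} (hR : R ∈ T.czSets) : R.Finite := by
  rcases hR with ⟨x, rfl⟩ | ⟨x, h, -, rfl⟩
  · exact Set.finite_singleton x
  · refine ((Set.finite_Iio (4 * h)).biUnion (t := fun n => {y | T.graph.dist y x = n})
      fun n _ => T.finite_dist_eq x n).subset fun y hy => ?_
    obtain ⟨hb, -, h2⟩ := hy
    refine Set.mem_biUnion (x := T.graph.dist y x) ?_ rfl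
    unfold LiesBelow at hb
    rw [hb] at h2
    simp only [Set.mem_Iio]
    push_cast at h2
    have h3 : (T.graph.dist y x : ℝ) < 4 * h := by linarith
    exact_mod_cast h3

theorem μ_lt_top [MeasurableSpace V] [DiscreteMeasurableSpace V] (T : WeightedTree V m)
    {K : Set V} (hK : K.Finite) : T.μ K < ∞ := by
  have hc : Measure.count K < ∞ := Measure.count_apply_lt_top.2 hK
  have : IsFiniteMeasure (Measure.count.restrict K) := ⟨by simpa using hc⟩
  rw [μ, withDensity_apply _ (MeasurableSet.of_discrete), ← hK.coe_toFinset,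
    lintegral_finset]
  refine ENNReal.sum_lt_top.2 fun x _ => ENNReal.mul_lt_top ENNReal.coe_lt_top ?_
  exact Measure.count_apply_lt_top.2 (Set.finite_singleton x)

theorem integrableOn_finite [MeasurableSpace V] [DiscreteMeasurableSpace V] (T : WeightedTree V m)
    {K : Set V} (hK : K.Finite) (f : V → ℂ) : IntegrableOn f K T.μ := by
  have : IsFiniteMeasure (T.μ.restrict K) := ⟨by simpa using T.μ_lt_top hK⟩
  have h := IntegrableOn.of_finite (μ := T.μ.restrict K) (f := f) hK
  rwa [IntegrableOn, Measure.restrict_restrict (MeasurableSet.of_discrete), Set.inter_self] at h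

/-! Hardy spaces. -/

/-- `(1, p)`-atoms. -/
def IsAtom [MeasurableSpace V] (T : WeightedTree V m) (p : ℝ≥0∞) (a : V → ℂ) : Prop :=
  ∃ R ∈ T.czSets, Function.support a ⊆ R ∧
    eLpNorm a p T.μ ≤ T.μ R ^ ((p⁻¹).toReal - 1) ∧ ∫ x, a x ∂T.μ = 0

/-- `g = ∑ λ_j a_j` with `(1, p)`-atoms `a_j` and `∑ |λ_j| < ∞`.  (Each vertex has positive mass
and each atom has `L¹`-norm at most one, so the series converges at each vertex and in `L¹`.) -/
def IsAtomicDecomposition [MeasurableSpace V] (T : WeightedTree V m) (p : ℝ≥0∞) (g : V → ℂ)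
    (c : ℕ → ℂ) (a : ℕ → V → ℂ) : Prop :=
  (∀ j, T.IsAtom p (a j)) ∧ Summable (fun j => ‖c j‖) ∧ ∀ x, HasSum (fun j => c j * a j x) (g x)

theorem isAtom_zero [MeasurableSpace V] (T : WeightedTree V m) (p : ℝ≥0∞) : T.IsAtom p 0 := by
  obtain ⟨x⟩ := T.isTree.1.nonempty
  exact ⟨{x}, Or.inl ⟨x, rfl⟩, by simp, by simp, by simp⟩

theorem hasSum_sumType {E : Type*} [AddCommMonoid E] [TopologicalSpace E] [ContinuousAdd E]
    {f : ℕ ⊕ ℕ → E} {a b : E} (h₁ : HasSum (fun i => f (Sum.inl i)) a)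
    (h₂ : HasSum (fun i => f (Sum.inr i)) b) : HasSum f (a + b) :=
  HasSum.sum h₁ h₂

theorem IsAtomicDecomposition.add [MeasurableSpace V] {T : WeightedTree V m} {p : ℝ≥0∞}
    {g g' : V → ℂ} {c c' : ℕ → ℂ} {a a' : ℕ → V → ℂ} (h : T.IsAtomicDecomposition p g c a)
    (h' : T.IsAtomicDecomposition p g' c' a') :
    ∃ c a, T.IsAtomicDecomposition p (g + g') c a := by
  obtain ⟨e⟩ : Nonempty (ℕ ≃ ℕ ⊕ ℕ) := ⟨Equiv.natSumNatEquivNat.symm⟩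
  refine ⟨fun j => Sum.elim c c' (e j), fun j => Sum.elim a a' (e j), fun j => ?_, ?_, fun x => ?_⟩
  · show T.IsAtom p (Sum.elim a a' (e j))
    rcases e j with i | i
    · exact h.1 i
    · exact h'.1 i
  · have hs : HasSum (fun s => ‖Sum.elim c c' s‖) _ := hasSum_sumType h.2.1.hasSum h'.2.1.hasSum
    exact ((Equiv.hasSum_iff e).2 hs).summable
  · have hs : HasSum (fun s => Sum.elim c c' s * Sum.elim a a' s x) (g x + g' x) :=
      hasSum_sumType (h.2.2 x) (h'.2.2 x)
    exact (Equiv.hasSum_iff e).2 hs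

/-- The Hardy space `H^{1,p}(μ)`. -/
def hardy [MeasurableSpace V] (T : WeightedTree V m) (p : ℝ≥0∞) : Submodule ℂ (V → ℂ) where
  carrier := {g | Integrable g T.μ ∧ ∃ c a, T.IsAtomicDecomposition p g c a}
  zero_mem' := ⟨integrable_zero _ _ _, fun _ => 0, fun _ => 0, fun _ => T.isAtom_zero p,
    by simp, fun x => by simp⟩
  add_mem' := by
    rintro g g' ⟨hg, c, a, h⟩ ⟨hg', c', a', h'⟩
    exact ⟨hg.add hg', h.add h'⟩
  smul_mem' := by
    rintro b g ⟨hg, c, a, ha, hc, hs⟩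
    refine ⟨hg.smul b, fun j => b * c j, a, ha, ?_, fun x => ?_⟩
    · simpa only [norm_mul] using hc.mul_left ‖b‖
    · simpa only [mul_assoc, Pi.smul_apply, smul_eq_mul] using (hs x).mul_left b

/-- The norm of `H^{1,p}(μ)`: the infimum of `∑ |λ_j|` over all atomic decompositions. -/
def hardyNorm [MeasurableSpace V] (T : WeightedTree V m) (p : ℝ≥0∞) (g : V → ℂ) : ℝ≥0∞ :=
  ⨅ (c : ℕ → ℂ) (a : ℕ → V → ℂ) (_ : T.IsAtomicDecomposition p g c a), ∑' j, ‖c j‖ₑ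

/-- The space of finite linear combinations of `(1, p)`-atoms. -/
def hardyFin [MeasurableSpace V] (T : WeightedTree V m) (p : ℝ≥0∞) : Submodule ℂ (V → ℂ) :=
  Submodule.span ℂ {a | T.IsAtom p a}

/-! BMO spaces. -/

/-- The `q`-mean oscillation of `f` on `R`. -/
def osc [MeasurableSpace V] (T : WeightedTree V m) (q : ℝ) (f : V → ℂ) (R : Set V) : ℝ≥0∞ :=
  ((T.μ R)⁻¹ * ∫⁻ x in R, ‖f x - ⨍ y in R, f y ∂T.μ‖ₑ ^ q ∂T.μ) ^ (1 / q)

/-- The supremum of the `q`-mean oscillations of `f` on the Calderón–Zygmund sets. -/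
def supOsc [MeasurableSpace V] (T : WeightedTree V m) (q : ℝ) (f : V → ℂ) : ℝ≥0∞ :=
  ⨆ R ∈ T.czSets, T.osc q f R

/-- The functions in `L^q_loc(μ)` with bounded `q`-mean oscillation.  (The compact subsets of `V`
with its graph distance are the finite ones.) -/
def bmoFun [MeasurableSpace V] (T : WeightedTree V m) (q : ℝ) : Set (V → ℂ) :=
  {f | (∀ K : Set V, K.Finite → MemLp f (ENNReal.ofReal q) (T.μ.restrict K)) ∧ T.supOsc q f < ∞}

/-- The constant functions. -/
def constants (V : Type*) : Submodule ℂ (V → ℂ) where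
  carrier := {f | ∃ c : ℂ, f = fun _ => c}
  zero_mem' := ⟨0, rfl⟩
  add_mem' := by
    rintro _ _ ⟨c, rfl⟩ ⟨d, rfl⟩
    exact ⟨c + d, rfl⟩
  smul_mem' := by
    rintro b _ ⟨c, rfl⟩
    exact ⟨b * c, rfl⟩

/-- `BMO_q(μ)`: functions of bounded `q`-mean oscillation modulo constants. -/
def bmo [MeasurableSpace V] (T : WeightedTree V m) (q : ℝ) : Set ((V → ℂ) ⧸ constants V) :=
  (constants V).mkQ '' T.bmoFun q

theorem osc_add_const [MeasurableSpace V] [DiscreteMeasurableSpace V] (T : WeightedTree V m)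
    (q : ℝ) (f : V → ℂ) (c : ℂ) {R : Set V} (hR : R ∈ T.czSets) :
    T.osc q (fun x => f x + c) R = T.osc q f R := by
  have hfin := T.czSets_finite hR
  have hμ := T.μ_lt_top hfin
  by_cases h0 : T.μ R = 0
  · simp [osc, Measure.restrict_eq_zero.2 h0]
  · have havg : ⨍ y in R, (f y + c) ∂T.μ = (⨍ y in R, f y ∂T.μ) + c := by
      have hne : T.μ.real R ≠ 0 := (ENNReal.toReal_pos h0 hμ.ne).ne'
      have hcc : IntegrableOn (fun _ : V => c) R T.μ := T.integrableOn_finite hfin _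
      rw [setAverage_eq, setAverage_eq, integral_add (T.integrableOn_finite hfin f) hcc, smul_add,
        setIntegral_const, inv_smul_smul₀ hne]
    simp only [osc, havg, add_sub_add_right_eq_sub]

/-- The norm of `BMO_q(μ)`, well defined modulo constants. -/
def bmoNorm [MeasurableSpace V] [DiscreteMeasurableSpace V] (T : WeightedTree V m) (q : ℝ)
    (F : (V → ℂ) ⧸ constants V) : ℝ≥0∞ :=
  Quotient.liftOn' F (T.supOsc q) (by
    intro f f' h
    obtain ⟨c, hc⟩ := (Submodule.quotientRel_def _).1 h
    have hf : f = fun x => f' x + c := by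
      funext x
      have := congrFun hc x
      simp only [Pi.sub_apply] at this
      rw [← this]; ring
    rw [hf]
    exact iSup_congr fun R => iSup_congr fun hR => T.osc_add_const q f' c hR)

/-- `L` is a linear functional on `H^1(μ) = H^{1,∞}(μ)` that is integration against `f` on finite
combinations of `(1, ∞)`-atoms, with `‖L‖ ≤ B`. -/
def Represents [MeasurableSpace V] (T : WeightedTree V m) (f : V → ℂ) (B : ℝ≥0∞)
    (L : T.hardy ∞ →ₗ[ℂ] ℂ) : Prop :=
  (∀ g : T.hardy ∞, (g : V → ℂ) ∈ T.hardyFin ∞ → L g = ∫ x, f x * (g : V → ℂ) x ∂T.μ) ∧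
    ∀ g : T.hardy ∞, ‖L g‖ₑ ≤ B * T.hardyNorm ∞ g

end

end WeightedTree

/-! The level is a Busemann function: every vertex has one neighbour a level higher, its parent, and
`m` neighbours a level lower. Passing to the children divides the mass of a vertex by `m`, so each
generation below `x` has the same total mass as `x`, and a set of `n` consecutive generations below
`x` (a box) has mass `n` times that of `x`. The graph grows exponentially and is not doubling, but
the boxes comparable to Calderón–Zygmund sets behave like dyadic cubes: each one splits, through
children or by halving the range of levels, into boxes of the same kind whose masses are smaller by
a factor of at most `m + 1`, until singletons remain (`isRegularSplitting_boxes`).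

A stopping-time argument on this splitting gives a Calderón–Zygmund decomposition in which no
covering lemma or maximal function is needed (`exists_bounded_part`). A mean-zero function on a box
becomes a bounded mean-zero function plus mean-zero functions on strictly smaller boxes. With a high
enough stopping level the second part costs at most half of the bound to be proved. Induction on
finite sets therefore closes, and controls the `H^{1,∞}` norm by `L^p` averages (`exists_gaugeLe`).
Applied to `(1,p)`-atoms and summed, this identifies `H^{1,p}` with `H^{1,∞}`.

For the functional, `f * g` need not be integrable. Truncations of `f` are bounded and are
contractions of `f`, so against an atom they give at most the mean oscillation of `f`; the
functional is the limit of the truncated integrals. The comparison of the `BMO` norms is then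
duality on one box: the function extremal for the `q`-oscillation, made mean-zero, is tested against
`f`, and its Hardy norm is bounded by the gauge estimate (`osc_le_of_gaugeLe`). -/

namespace SimpleGraph

/-! ### Neighbours closer to a given vertex. -/

variable {V : Type*} {G : SimpleGraph V}

/-- In a tree, at most one neighbour of `v` is closer than `v` to `x`. -/
theorem IsTree.eq_of_adj_of_dist_add_one (hG : G.IsTree) {v x a b : V} (ha : G.Adj v a)
    (hb : G.Adj v b) (hax : G.dist a x + 1 = G.dist v x) (hbx : G.dist b x + 1 = G.dist v x) :
    a = b := by
  obtain ⟨p, hp⟩ := hG.1.exists_walk_length_eq_dist a x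
  obtain ⟨q, hq⟩ := hG.1.exists_walk_length_eq_dist b x
  -- Both extended walks have minimal length, hence are paths from `v` to `x`; a tree has only one,
  -- and its second vertex is both `a` and `b`.
  have hp' : (Walk.cons ha p).IsPath := Walk.isPath_of_length_eq_dist _ (by simp [hp, hax])
  have hq' : (Walk.cons hb q).IsPath := Walk.isPath_of_length_eq_dist _ (by simp [hq, hbx])
  have h := (hG.existsUnique_path v x).unique hp' hq'
  simpa using congrArg Walk.snd h

/-- In a connected graph, each vertex other than `x` has a neighbour closer to `x`. -/
theorem Connected.exists_adj_dist_add_one (hG : G.Connected) {v x : V} {k : ℕ}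
    (h : G.dist v x = k + 1) : ∃ a, G.Adj v a ∧ G.dist a x = k := by
  obtain ⟨p, hp⟩ := hG.exists_walk_length_eq_dist v x
  cases p with
  | nil => simp at h
  | @cons _ a _ hadj p =>
    refine ⟨a, hadj, ?_⟩
    have h1 : G.dist a x ≤ p.length := G.dist_le p
    have h2 : G.dist v x ≤ G.dist v a + G.dist a x := hG.dist_triangle
    rw [dist_eq_one_iff_adj.2 hadj] at h2
    simp only [Walk.length_cons] at hp
    omega

end SimpleGraph

namespace WeightedTree

noncomputable section

variable {V : Type*} {m : ℕ}

/-! Levels and parents. -/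

theorem N_injective (T : WeightedTree V m) : Function.Injective T.N := by
  intro x y h
  have h1 := T.abs_N_sub x y
  rw [h, sub_self, abs_zero] at h1
  exact Subtype.ext (T.isTree.1.dist_eq_zero_iff.1 (by exact_mod_cast h1.symm))

theorem adj_of_N_eq_add_one (T : WeightedTree V m) {x y : T.geodesic} (h : T.N y = T.N x + 1) :
    T.graph.Adj (x : V) y := by
  have h1 := T.abs_N_sub x y
  rw [h, show T.N x - (T.N x + 1) = -1 by ring, abs_neg, abs_one] at h1
  exact SimpleGraph.dist_eq_one_iff_adj.1 (by exact_mod_cast h1.symm)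

theorem exists_N_eq_add_one (T : WeightedTree V m) (x : T.geodesic) :
    ∃ y : T.geodesic, T.N y = T.N x + 1 := by
  obtain ⟨a, b, hab, hs⟩ := Set.ncard_eq_two.1 (T.geodesic_neighbors x x.2)
  have ha : a ∈ T.graph.neighborSet x ∩ T.geodesic := by rw [hs]; simp
  have hb : b ∈ T.graph.neighborSet x ∩ T.geodesic := by rw [hs]; simp
  have key : ∀ c (hc : c ∈ T.graph.neighborSet x ∩ T.geodesic),
      T.N ⟨c, hc.2⟩ = T.N x + 1 ∨ T.N ⟨c, hc.2⟩ = T.N x - 1 := by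
    intro c hc
    have h1 := T.abs_N_sub x ⟨c, hc.2⟩
    rw [SimpleGraph.dist_eq_one_iff_adj.2 hc.1] at h1
    rcases (abs_eq (by norm_num)).1 h1 with h | h
    · right; push_cast at h; linarith
    · left; push_cast at h; linarith
  rcases key a ha with h | h
  · exact ⟨_, h⟩
  · rcases key b hb with h' | h'
    · exact ⟨_, h'⟩
    · exact absurd (congrArg Subtype.val (T.N_injective (h.trans h'.symm))) hab

theorem exists_N_eq_add (T : WeightedTree V m) (x : T.geodesic) (k : ℕ) :
    ∃ y : T.geodesic, T.N y = T.N x + k := by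
  induction k with
  | zero => exact ⟨x, by simp⟩
  | succ k ih =>
    obtain ⟨y, hy⟩ := ih
    obtain ⟨z, hz⟩ := T.exists_N_eq_add_one y
    exact ⟨z, by rw [hz, hy]; push_cast; ring⟩

theorem dist_nearest_le (T : WeightedTree V m) (x : V) (z : T.geodesic) :
    T.graph.dist x (T.nearest x) ≤ T.graph.dist x z :=
  (T.exists_nearest x).choose_spec z

/-- Each step up the geodesic changes the distance to `x` by exactly one. The first cannot decrease
it, by minimality at the nearest point. A later decrease from `z` to `y` would make both `y` and the
predecessor `u` of `z` neighbours of `z` closer to `x`, so `y = u`, contradicting the numbering. -/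
theorem dist_eq_of_N_eq_nearest_add (T : WeightedTree V m) (x : V) (k : ℕ) (y : T.geodesic)
    (hy : T.N y = T.N (T.nearest x) + k) :
    T.graph.dist y x = T.graph.dist x (T.nearest x) + k := by
  induction k using Nat.strong_induction_on generalizing y with
  | _ k ih =>
    match k, ih with
    | 0, _ =>
      rw [T.N_injective (a₁ := y) (a₂ := T.nearest x) (by simpa using hy), SimpleGraph.dist_comm,
        add_zero]
    | k + 1, ih =>
      obtain ⟨z, hz⟩ := T.exists_N_eq_add (T.nearest x) k
      have hzd := ih k (by omega) z hz
      have hadj : T.graph.Adj (z : V) y := T.adj_of_N_eq_add_one (by rw [hy, hz]; push_cast; ring)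
      have hd := T.isTree.dist_eq_dist_add_one_of_adj x hadj
      rw [SimpleGraph.dist_comm (v := (z : V)), SimpleGraph.dist_comm (v := (y : V))] at hd
      rcases hd with hd | hd
      · exfalso
        rcases k with _ | k
        · have h := T.dist_nearest_le x y
          rw [SimpleGraph.dist_comm (v := (y : V))] at h
          omega
        · obtain ⟨u, hu⟩ := T.exists_N_eq_add (T.nearest x) k
          have hud := ih k (by omega) u hu
          have huz : T.graph.Adj (u : V) z :=
            T.adj_of_N_eq_add_one (by rw [hu, hz]; push_cast; ring)
          have := T.isTree.eq_of_adj_of_dist_add_one hadj huz.symm hd.symm (by omega)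
          rw [Subtype.ext this, hu] at hy
          push_cast at hy
          linarith
      · omega

/-- The level is the Busemann function of the upper end of the geodesic. -/
theorem eventually_level_eq (T : WeightedTree V m) (x : V) :
    ∀ᶠ n : ℤ in Filter.atTop, ∀ y : T.geodesic, T.N y = n →
      T.level x = n - T.graph.dist (y : V) x := by
  filter_upwards [Filter.eventually_ge_atTop (T.N (T.nearest x))] with n hn y hy
  obtain ⟨k, hk⟩ := Int.eq_ofNat_of_zero_le (sub_nonneg.2 hn)
  rw [T.dist_eq_of_N_eq_nearest_add x k y (by rw [hy]; linarith), level]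
  push_cast
  linarith

theorem finite_neighborSet (T : WeightedTree V m) (x : V) : (T.graph.neighborSet x).Finite :=
  Set.finite_of_ncard_ne_zero (by rw [T.card_neighbors]; omega)

/-- A vertex of the geodesic high enough to compute the level of `x` and of its neighbours. -/
theorem exists_high_vertex (T : WeightedTree V m) (x : V) :
    ∃ (y : V) (n : ℤ), T.level x = n - T.graph.dist y x ∧ 0 < T.graph.dist y x ∧
      ∀ z, T.graph.Adj x z → T.level z = n - T.graph.dist y z := by
  have h1 : ∀ᶠ n : ℤ in Filter.atTop, ∀ z ∈ T.graph.neighborSet x, ∀ y : T.geodesic, T.N y = n →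
      T.level z = n - T.graph.dist (y : V) z :=
    (Filter.eventually_all_finite (T.finite_neighborSet x)).2 fun z _ => T.eventually_level_eq z
  obtain ⟨n, ⟨⟨hx, hz⟩, hn⟩, hn'⟩ := (((T.eventually_level_eq x).and h1).and
    ((Filter.eventually_gt_atTop (T.level x)).and
      (Filter.eventually_ge_atTop (T.N (T.nearest x))))).exists.imp fun n h =>
        (⟨⟨h.1, h.2.1⟩, h.2.2⟩ : ((_ ∧ _) ∧ _) ∧ _)
  obtain ⟨k, hk⟩ := Int.eq_ofNat_of_zero_le (sub_nonneg.2 hn')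
  obtain ⟨y, hy⟩ := T.exists_N_eq_add (T.nearest x) k
  have hy : T.N y = n := by rw [hy]; linarith
  refine ⟨y, n, hx y hy, ?_, fun z h => hz z h y hy⟩
  have := hx y hy
  omega

/-- Seen from a high vertex `y` of the geodesic, the level rises by one exactly when the distance to
`y` drops by one, and one neighbour of `x` alone is closer to `y`. -/
theorem existsUnique_parent (T : WeightedTree V m) (x : V) :
    ∃! z, T.graph.Adj x z ∧ T.level z = T.level x + 1 := by
  obtain ⟨y, n, hx, hpos, hz⟩ := T.exists_high_vertex x
  obtain ⟨k, hk⟩ : ∃ k, T.graph.dist x y = k + 1 :=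
    ⟨T.graph.dist x y - 1, by rw [SimpleGraph.dist_comm]; omega⟩
  obtain ⟨z, hadj, hzd⟩ := T.isTree.1.exists_adj_dist_add_one hk
  rw [SimpleGraph.dist_comm] at hk hzd
  refine ⟨z, ⟨hadj, ?_⟩, ?_⟩
  · rw [hz z hadj, hx, hk, hzd]; push_cast; ring
  · rintro w ⟨hw, hwl⟩
    have := hz w hw
    refine T.isTree.eq_of_adj_of_dist_add_one (x := y) hw hadj ?_ ?_ <;>
      simp only [SimpleGraph.dist_comm (v := y)] <;> omega

/-- The neighbour of `x` one level above `x`. -/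
def parent (T : WeightedTree V m) (x : V) : V := (T.existsUnique_parent x).choose

theorem adj_parent (T : WeightedTree V m) (x : V) : T.graph.Adj x (T.parent x) :=
  (T.existsUnique_parent x).choose_spec.1.1

theorem level_parent (T : WeightedTree V m) (x : V) : T.level (T.parent x) = T.level x + 1 :=
  (T.existsUnique_parent x).choose_spec.1.2

theorem eq_parent (T : WeightedTree V m) {x z : V} (h : T.graph.Adj x z)
    (hl : T.level z = T.level x + 1) : z = T.parent x :=
  (T.existsUnique_parent x).unique ⟨h, hl⟩ ⟨T.adj_parent x, T.level_parent x⟩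

theorem level_of_adj (T : WeightedTree V m) {x z : V} (h : T.graph.Adj x z) :
    T.level z = T.level x + 1 ∨ T.level z = T.level x - 1 := by
  obtain ⟨y, n, hx, -, hz⟩ := T.exists_high_vertex x
  have := hz z h
  have := T.isTree.dist_eq_dist_add_one_of_adj y h
  omega

theorem adj_iff_parent (T : WeightedTree V m) {x z : V} :
    T.graph.Adj x z ↔ z = T.parent x ∨ T.parent z = x := by
  constructor
  · intro h
    rcases T.level_of_adj h with hl | hl
    · exact Or.inl (T.eq_parent h hl)
    · exact Or.inr (T.eq_parent h.symm (by linarith)).symm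
  · rintro (rfl | rfl)
    · exact T.adj_parent x
    · exact (T.adj_parent z).symm

theorem level_le_add_dist (T : WeightedTree V m) (x y : V) :
    T.level x ≤ T.level y + T.graph.dist x y := by
  obtain ⟨k, hk⟩ : ∃ k, T.graph.dist x y = k := ⟨_, rfl⟩
  induction k generalizing x with
  | zero => simp [T.isTree.1.dist_eq_zero_iff.1 hk]
  | succ k ih =>
    obtain ⟨a, ha, hak⟩ := T.isTree.1.exists_adj_dist_add_one hk
    have := ih a hak
    rw [hk]
    rw [hak] at this
    have := T.level_of_adj ha
    push_cast
    omega

theorem level_iterate_parent (T : WeightedTree V m) (k : ℕ) (x : V) :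
    T.level (T.parent^[k] x) = T.level x + k := by
  induction k generalizing x with
  | zero => simp
  | succ k ih => rw [Function.iterate_succ_apply, ih, level_parent]; push_cast; ring

theorem dist_iterate_parent_le (T : WeightedTree V m) (k : ℕ) (x : V) :
    T.graph.dist x (T.parent^[k] x) ≤ k := by
  induction k generalizing x with
  | zero => simp
  | succ k ih =>
    have h1 := ih (T.parent x)
    have h2 := T.isTree.1.dist_triangle (u := x) (v := T.parent x)
      (w := T.parent^[k] (T.parent x))
    rw [SimpleGraph.dist_eq_one_iff_adj.2 (T.adj_parent x)] at h2
    rw [Function.iterate_succ_apply]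
    omega

/-- The level changes by one along each edge. If the difference of levels equals the distance, every
step of a shortest walk from `x` to `y` must go up, and the only way up is the parent. -/
theorem liesBelow_iff (T : WeightedTree V m) {x y : V} :
    T.LiesBelow x y ↔ ∃ k : ℕ, T.parent^[k] x = y := by
  constructor
  · intro h
    refine ⟨T.graph.dist x y, ?_⟩
    unfold LiesBelow at h
    obtain ⟨k, hk⟩ : ∃ k, T.graph.dist x y = k := ⟨_, rfl⟩
    rw [hk] at h ⊢
    induction k generalizing x with
    | zero => simpa using T.isTree.1.dist_eq_zero_iff.1 hk
    | succ k ih =>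
      obtain ⟨a, ha, hak⟩ := T.isTree.1.exists_adj_dist_add_one hk
      have h1 := T.level_le_add_dist y a
      rw [SimpleGraph.dist_comm, hak] at h1
      have h2 := T.level_of_adj ha
      push_cast at h
      have h3 : T.level a = T.level x + 1 := by omega
      rw [Function.iterate_succ_apply, ← T.eq_parent ha h3]
      exact ih (by omega) hak
  · rintro ⟨k, rfl⟩
    have h1 := T.level_le_add_dist (T.parent^[k] x) x
    have h2 := T.dist_iterate_parent_le k x
    rw [SimpleGraph.dist_comm] at h1
    unfold LiesBelow
    rw [level_iterate_parent] at h1 ⊢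
    omega

/-! Children, boxes and weights. -/

/-- The vertices whose parent is `x`. -/
def children (T : WeightedTree V m) (x : V) : Finset V :=
  ((T.finite_neighborSet x).subset (t := {z | T.parent z = x}) fun _ hz =>
    T.adj_iff_parent.2 (Or.inr hz)).toFinset

@[simp] theorem mem_children (T : WeightedTree V m) {x z : V} :
    z ∈ T.children x ↔ T.parent z = x := by
  simp [children]

theorem card_children (T : WeightedTree V m) (x : V) : (T.children x).card = m := by
  have h1 : T.graph.neighborSet x = insert (T.parent x) (T.children x : Set V) := by
    ext z
    simp [T.adj_iff_parent]
  have h2 : T.parent x ∉ (T.children x : Set V) := by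
    intro h
    have h := congrArg T.level (T.mem_children.1 h)
    rw [level_parent, level_parent] at h
    linarith
  have h3 := T.card_neighbors x
  rw [h1, Set.ncard_insert_of_notMem h2 (Finset.finite_toSet _), Set.ncard_coe_finset] at h3
  omega

/-- The mass of a vertex. -/
def weight (T : WeightedTree V m) (x : V) : ℝ := (m : ℝ) ^ T.level x

theorem weight_pos (hm : 2 ≤ m) (T : WeightedTree V m) (x : V) : 0 < T.weight x :=
  zpow_pos (by exact_mod_cast (by omega : 0 < m)) _

theorem weight_of_parent_eq (hm : 2 ≤ m) (T : WeightedTree V m) {x z : V} (h : T.parent z = x) :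
    T.weight x = m * T.weight z := by
  have : (m : ℝ) ≠ 0 := by exact_mod_cast (by omega : m ≠ 0)
  rw [weight, weight, ← h, level_parent, zpow_add_one₀ this, mul_comm]

open Classical in
/-- The vertices `k` levels below `x`. -/
def descendants (T : WeightedTree V m) : ℕ → V → Finset V
  | 0, x => {x}
  | k + 1, x => (T.children x).biUnion (T.descendants k)

@[simp] theorem mem_descendants (T : WeightedTree V m) {k : ℕ} {x y : V} :
    y ∈ T.descendants k x ↔ T.parent^[k] y = x := by
  induction k generalizing x with
  | zero => simp [descendants]
  | succ k ih => simp [descendants, ih, Function.iterate_succ_apply']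

theorem sum_weight_children (hm : 2 ≤ m) (T : WeightedTree V m) (x : V) :
    ∑ z ∈ T.children x, T.weight z = T.weight x := by
  have hm' : (m : ℝ) ≠ 0 := by exact_mod_cast (by omega : m ≠ 0)
  have : ∀ z ∈ T.children x, T.weight z = T.weight x / m := fun z hz => by
    rw [T.weight_of_parent_eq hm (T.mem_children.1 hz), mul_div_cancel_left₀ _ hm']
  rw [Finset.sum_congr rfl this, Finset.sum_const, card_children, nsmul_eq_mul,
    mul_div_cancel₀ _ hm']

/-- Mass is conserved from one generation to the next, which is why the mass of a box depends only
on its root and its number of levels. -/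
theorem sum_weight_descendants (hm : 2 ≤ m) (T : WeightedTree V m) (k : ℕ) (x : V) :
    ∑ y ∈ T.descendants k x, T.weight y = T.weight x := by
  classical
  induction k generalizing x with
  | zero => simp [descendants]
  | succ k ih =>
    rw [descendants, Finset.sum_biUnion, Finset.sum_congr rfl fun z _ => ih z,
      T.sum_weight_children hm]
    intro z _ w _ hzw
    refine Finset.disjoint_left.2 fun y hy hy' => hzw ?_
    rw [mem_descendants] at hy hy'
    exact hy.symm.trans hy'

open Classical in
/-- The vertices at least `a` and less than `a + n` levels below `x`. -/
def box (T : WeightedTree V m) (x : V) (a n : ℕ) : Finset V :=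
  (Finset.range n).biUnion fun j => T.descendants (a + j) x

theorem mem_box (T : WeightedTree V m) {x y : V} {a n : ℕ} :
    y ∈ T.box x a n ↔ ∃ k, a ≤ k ∧ k < a + n ∧ T.parent^[k] y = x := by
  simp only [box, Finset.mem_biUnion, Finset.mem_range, mem_descendants]
  constructor
  · rintro ⟨j, hj, h⟩
    exact ⟨a + j, by omega, by omega, h⟩
  · rintro ⟨k, h1, h2, h⟩
    exact ⟨k - a, by omega, by rwa [Nat.add_sub_cancel' h1]⟩

theorem eq_of_iterate_parent_eq (T : WeightedTree V m) {x x' y : V} {k k' : ℕ}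
    (hk : T.parent^[k] y = x) (hk' : T.parent^[k'] y = x') (hl : T.level x = T.level x') :
    k = k' := by
  have h1 := T.level_iterate_parent k y
  have h2 := T.level_iterate_parent k' y
  rw [hk] at h1
  rw [hk'] at h2
  omega

theorem sum_weight_box (hm : 2 ≤ m) (T : WeightedTree V m) (x : V) (a n : ℕ) :
    ∑ y ∈ T.box x a n, T.weight y = n * T.weight x := by
  classical
  rw [box, Finset.sum_biUnion, Finset.sum_congr rfl fun j _ => T.sum_weight_descendants hm _ x,
    Finset.sum_const, Finset.card_range, nsmul_eq_mul]
  intro i _ j _ hij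
  refine Finset.disjoint_left.2 fun y hy hy' => hij ?_
  rw [mem_descendants] at hy hy'
  have := T.eq_of_iterate_parent_eq hy hy' rfl
  omega

/-- Depths are integers, so the real bound `h / 2` becomes its ceiling, which is `(h + 1) / 2` in
natural-number division. -/
theorem trapezoid_eq_box (T : WeightedTree V m) (x : V) (h : ℕ) :
    T.trapezoid x ((h : ℝ) / 2) (4 * h) = T.box x ((h + 1) / 2) (4 * h - (h + 1) / 2) := by
  ext y
  simp only [trapezoid, Set.mem_ofPred_eq, liesBelow_iff, Finset.mem_coe, mem_box]
  have key : ∀ k : ℕ, T.parent^[k] y = x → (((h : ℝ) / 2 ≤ ((T.level x - T.level y : ℤ) : ℝ) ∧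
      ((T.level x - T.level y : ℤ) : ℝ) < 4 * h) ↔ (h + 1) / 2 ≤ k ∧
        k < (h + 1) / 2 + (4 * h - (h + 1) / 2)) := by
    intro k hk
    have h1 : T.level x - T.level y = k := by rw [← hk, level_iterate_parent]; ring
    rw [h1]
    have e1 : ((h : ℝ) / 2 ≤ ((k : ℤ) : ℝ)) ↔ h ≤ 2 * k := by
      rw [div_le_iff₀ two_pos]
      constructor
      · intro h'; have : (h : ℝ) ≤ (2 * k : ℕ) := by push_cast at *; linarith
        exact_mod_cast this
      · intro h'; have : (h : ℝ) ≤ (2 * k : ℕ) := by exact_mod_cast h'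
        push_cast at *; linarith
    have e2 : (((k : ℤ) : ℝ) < 4 * h) ↔ k < 4 * h := by
      constructor
      · intro h'; have : (k : ℝ) < (4 * h : ℕ) := by push_cast at *; linarith
        exact_mod_cast this
      · intro h'; have : (k : ℝ) < (4 * h : ℕ) := by exact_mod_cast h'
        push_cast at *; linarith
    rw [e1, e2]
    omega
  constructor
  · rintro ⟨⟨k, hk⟩, h'⟩
    exact ⟨k, ((key k hk).1 h').1, ((key k hk).1 h').2, hk⟩
  · rintro ⟨k, h1, h2, hk⟩
    exact ⟨⟨k, hk⟩, (key k hk).2 ⟨h1, h2⟩⟩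

end

end WeightedTree

/-! Weighted sums over finite sets. -/

section WeightedSums

variable {V : Type*} {w : V → ℝ} {Q : Finset V} {p : ℝ}

/-- The mean of `f` over the finite set `Q` with respect to the weight `w`. -/
noncomputable def weightedMean (w : V → ℝ) (Q : Finset V) (f : V → ℂ) : ℂ :=
  (∑ x ∈ Q, (w x : ℂ) * f x) / ((∑ x ∈ Q, w x : ℝ) : ℂ)

theorem sum_weight_mul_weightedMean (hQ : 0 < ∑ x ∈ Q, w x) (f : V → ℂ) :
    ∑ x ∈ Q, (w x : ℂ) * weightedMean w Q f = ∑ x ∈ Q, (w x : ℂ) * f x := by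
  rw [← Finset.sum_mul, weightedMean, ← Complex.ofReal_sum,
    mul_div_cancel₀ _ (Complex.ofReal_ne_zero.2 hQ.ne')]

/-- Jensen's inequality for the `p`-th power. -/
theorem norm_weightedMean_rpow_le (hw : ∀ x, 0 ≤ w x) (hQ : 0 < ∑ x ∈ Q, w x) (hp : 1 ≤ p)
    (f : V → ℂ) : ‖weightedMean w Q f‖ ^ p ≤ (∑ x ∈ Q, w x * ‖f x‖ ^ p) / ∑ x ∈ Q, w x := by
  have h1 : ‖weightedMean w Q f‖ ≤ ∑ x ∈ Q, (w x / ∑ x ∈ Q, w x) * ‖f x‖ := by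
    rw [weightedMean, norm_div, Complex.norm_real, Real.norm_of_nonneg hQ.le,
      div_le_iff₀ hQ, Finset.sum_mul]
    refine (norm_sum_le _ _).trans (Finset.sum_le_sum fun x _ => ?_)
    rw [norm_mul, Complex.norm_real, Real.norm_of_nonneg (hw x)]
    apply le_of_eq
    field_simp
  have h2 := Real.rpow_arith_mean_le_arith_mean_rpow Q (fun x => w x / ∑ x ∈ Q, w x)
    (fun x => ‖f x‖) (fun x _ => div_nonneg (hw x) hQ.le)
    (by rw [← Finset.sum_div, div_self hQ.ne']) (fun x _ => norm_nonneg _) hp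
  refine (Real.rpow_le_rpow (norm_nonneg _) h1 (by linarith)).trans (h2.trans (le_of_eq ?_))
  rw [Finset.sum_div]
  exact Finset.sum_congr rfl fun x _ => by ring

theorem sum_weight_mul_norm_sub_weightedMean_rpow_le (hw : ∀ x, 0 ≤ w x)
    (hQ : 0 < ∑ x ∈ Q, w x) (hp : 1 ≤ p) (f : V → ℂ) :
    ∑ x ∈ Q, w x * ‖f x - weightedMean w Q f‖ ^ p ≤ 2 ^ p * ∑ x ∈ Q, w x * ‖f x‖ ^ p := by
  have h1 := norm_weightedMean_rpow_le hw hQ hp f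
  rw [le_div_iff₀ hQ, mul_comm] at h1
  have h2 : ∀ a b : ℝ, 0 ≤ a → 0 ≤ b → (a + b) ^ p ≤ 2 ^ (p - 1) * (a ^ p + b ^ p) := by
    intro a b ha hb
    lift a to ℝ≥0 using ha
    lift b to ℝ≥0 using hb
    exact_mod_cast NNReal.rpow_add_le_mul_rpow_add_rpow a b hp
  calc ∑ x ∈ Q, w x * ‖f x - weightedMean w Q f‖ ^ p
      ≤ ∑ x ∈ Q, w x * (2 ^ (p - 1) * (‖f x‖ ^ p + ‖weightedMean w Q f‖ ^ p)) := by
        refine Finset.sum_le_sum fun x _ => mul_le_mul_of_nonneg_left ?_ (hw x)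
        exact (Real.rpow_le_rpow (norm_nonneg _) (norm_sub_le _ _) (by linarith)).trans
          (h2 _ _ (norm_nonneg _) (norm_nonneg _))
    _ = 2 ^ (p - 1) * (∑ x ∈ Q, w x * ‖f x‖ ^ p +
          (∑ x ∈ Q, w x) * ‖weightedMean w Q f‖ ^ p) := by
        rw [Finset.sum_mul, ← Finset.sum_add_distrib, Finset.mul_sum]
        exact Finset.sum_congr rfl fun x _ => by ring
    _ ≤ 2 ^ (p - 1) * (∑ x ∈ Q, w x * ‖f x‖ ^ p + ∑ x ∈ Q, w x * ‖f x‖ ^ p) := by gcongr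
    _ = 2 ^ p * ∑ x ∈ Q, w x * ‖f x‖ ^ p := by
        rw [Real.rpow_sub_one two_ne_zero]; ring

end WeightedSums

/-! Calderón–Zygmund decomposition in a family of finite sets closed under regular splitting. -/

section Splitting

variable {V : Type*}

/-- Each set of the family `𝓑` is a singleton or the disjoint union of proper subsets in `𝓑` whose
weights are not smaller than its own by more than a factor `D`. -/
def IsRegularSplitting (w : V → ℝ) (𝓑 : Set (Finset V)) (D : ℝ) : Prop :=
  ∀ Q ∈ 𝓑, (∃ x, Q = {x}) ∨ ∃ s : Finset (Finset V),
    (∀ P ∈ s, P ∈ 𝓑 ∧ P ⊂ Q ∧ ∑ x ∈ Q, w x ≤ D * ∑ x ∈ P, w x) ∧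
    (∀ P ∈ s, ∀ P' ∈ s, ∀ x ∈ P, x ∈ P' → P = P') ∧ ∀ x, x ∈ Q ↔ ∃ P ∈ s, x ∈ P

/-- The gauge `N` of mean-zero functions supported in `Q` is at most `K` times the weight of `Q`
times the `L^p`-average. -/
def GaugeLe (w : V → ℝ) (N : (V → ℂ) → ℝ≥0∞) (p K : ℝ) (Q : Finset V) : Prop :=
  ∀ (u : V → ℂ) (s : ℝ), 0 < s → (∀ x ∉ Q, u x = 0) → ∑ x ∈ Q, (w x : ℂ) * u x = 0 →
    ∑ x ∈ Q, w x * ‖u x‖ ^ p ≤ s ^ p * ∑ x ∈ Q, w x → N u ≤ ENNReal.ofReal (K * s * ∑ x ∈ Q, w x)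

theorem sum_apply_of_mem {s : Finset (Finset V)} {h : Finset V → V → ℂ}
    (hs : ∀ P ∈ s, ∀ P' ∈ s, ∀ x ∈ P, x ∈ P' → P = P') (hh : ∀ P ∈ s, ∀ x ∉ P, h P x = 0)
    {P : Finset V} (hP : P ∈ s) {x : V} (hx : x ∈ P) : (∑ P ∈ s, h P) x = h P x := by
  rw [Finset.sum_apply]
  refine Finset.sum_eq_single_of_mem P hP fun P' hP' hne => hh P' hP' x fun hx' => hne ?_
  exact hs P' hP' P hP x hx' hx

theorem sum_eq_sum_sum {M : Type*} [AddCommMonoid M] {Q : Finset V} {s : Finset (Finset V)}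
    (hs : ∀ P ∈ s, ∀ P' ∈ s, ∀ x ∈ P, x ∈ P' → P = P') (hQ : ∀ x, x ∈ Q ↔ ∃ P ∈ s, x ∈ P)
    (F : V → M) : ∑ x ∈ Q, F x = ∑ P ∈ s, ∑ x ∈ P, F x := by
  classical
  have h1 : Q = s.biUnion id := by ext x; simp [hQ]
  rw [h1, Finset.sum_biUnion]
  · rfl
  · intro P hP P' hP' hne
    exact Finset.disjoint_left.2 fun x hx hx' => hne (hs P hP P' hP' x hx hx')

/-- Calderón–Zygmund decomposition at height `t`: descend through the splitting and stop at the
first sets where the average of `‖f‖ ^ p` exceeds `t ^ p`. There `g` is the mean of `f`, and the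
remainder has mean zero on a proper subset, so `hrec` applies to it. The hypothesis `hrec` is what
the induction in `exists_gaugeLe` supplies. -/
theorem exists_bounded_part {w : V → ℝ} (hw : ∀ x, 0 < w x) {𝓑 : Set (Finset V)} {D : ℝ}
    (hD : 1 ≤ D) (h𝓑 : IsRegularSplitting w 𝓑 D) {N : (V → ℂ) → ℝ≥0∞} (hN0 : N 0 = 0)
    (hNadd : ∀ f g, N (f + g) ≤ N f + N g) {p t K : ℝ} (hp : 1 ≤ p) (ht : 0 < t) (hK : 0 ≤ K)
    (f : V → ℂ) (Q : Finset V) (hQ : Q ∈ 𝓑) (hQ0 : 0 < ∑ x ∈ Q, w x)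
    (hrec : ∀ P ∈ 𝓑, P ⊂ Q → GaugeLe w N p K P)
    (hf : ∑ x ∈ Q, w x * ‖f x‖ ^ p ≤ t ^ p * ∑ x ∈ Q, w x) :
    ∃ g : V → ℂ, (∀ x ∉ Q, g x = 0) ∧ (∀ x, ‖g x‖ ≤ D * t) ∧
      ∑ x ∈ Q, (w x : ℂ) * g x = ∑ x ∈ Q, (w x : ℂ) * f x ∧
      N ((Q : Set V).indicator f - g) ≤
        ENNReal.ofReal (K * (2 * D * t) * (t ^ p)⁻¹ * ∑ x ∈ Q, w x * ‖f x‖ ^ p) := by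
  classical
  have htp : 0 < t ^ p := Real.rpow_pos_of_pos ht p
  have hw' : ∀ x, 0 ≤ w x := fun x => (hw x).le
  have hc : 0 ≤ K * (2 * D * t) * (t ^ p)⁻¹ := by positivity
  have hsum0 : ∀ P : Finset V, 0 ≤ ∑ x ∈ P, w x * ‖f x‖ ^ p := fun P =>
    Finset.sum_nonneg fun x _ => mul_nonneg (hw' x) (Real.rpow_nonneg (norm_nonneg _) _)
  induction Q using Finset.strongInduction with
  | H Q ih =>
    rcases h𝓑 Q hQ with ⟨x, rfl⟩ | ⟨s, hs, hdisj, hmem⟩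
    -- On a singleton the average is the value itself, so `f` is already bounded by `t` and nothing
    -- is left over.
    · refine ⟨((({x} : Finset V)) : Set V).indicator f, ?_, ?_, ?_, ?_⟩
      · intro y hy
        exact Set.indicator_of_notMem (by simpa using hy) f
      · intro y
        by_cases hy : y ∈ ((({x} : Finset V)) : Set V)
        · rw [Set.indicator_of_mem hy]
          obtain rfl : y = x := by simpa using hy
          simp only [Finset.sum_singleton] at hf
          rw [mul_comm] at hf
          have h1 := le_of_mul_le_mul_right hf (hw y)
          have h2 := (Real.rpow_le_rpow_iff (norm_nonneg _) ht.le (by linarith)).1 h1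
          nlinarith
        · rw [Set.indicator_of_notMem hy, norm_zero]
          positivity
      · simp
      · rw [sub_self, hN0]
        exact zero_le
    · have hpos : ∀ P ∈ s, 0 < ∑ x ∈ P, w x := by
        intro P hP
        have := hs P hP
        by_contra hcon
        nlinarith [this.2.2]
      have hloc : ∀ P ∈ s, ∃ g : V → ℂ, (∀ x ∉ P, g x = 0) ∧ (∀ x, ‖g x‖ ≤ D * t) ∧
          ∑ x ∈ P, (w x : ℂ) * g x = ∑ x ∈ P, (w x : ℂ) * f x ∧
          N ((P : Set V).indicator f - g) ≤
            ENNReal.ofReal (K * (2 * D * t) * (t ^ p)⁻¹ * ∑ x ∈ P, w x * ‖f x‖ ^ p) := by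
        intro P hP
        obtain ⟨hP1, hP2, hP3⟩ := hs P hP
        by_cases hle : ∑ x ∈ P, w x * ‖f x‖ ^ p ≤ t ^ p * ∑ x ∈ P, w x
        · exact ih P hP2 hP1 (hpos P hP)
            (fun P' h1 h2 => hrec P' h1 (h2.trans hP2)) hle
        -- A stopping set. Its parent set `Q` was not stopped and is heavier by a factor of at most
        -- `D`, so the average on `P` is at most `D * t ^ p ≤ (D * t) ^ p`.
        · push Not at hle
          have hPQ : ∑ x ∈ P, w x * ‖f x‖ ^ p ≤ (D * t) ^ p * ∑ x ∈ P, w x := by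
            calc ∑ x ∈ P, w x * ‖f x‖ ^ p ≤ ∑ x ∈ Q, w x * ‖f x‖ ^ p :=
                  Finset.sum_le_sum_of_subset_of_nonneg hP2.1 fun x _ _ =>
                    mul_nonneg (hw' x) (Real.rpow_nonneg (norm_nonneg _) _)
              _ ≤ t ^ p * ∑ x ∈ Q, w x := hf
              _ ≤ t ^ p * (D * ∑ x ∈ P, w x) := by gcongr
              _ ≤ t ^ p * (D ^ p * ∑ x ∈ P, w x) := by
                  have := hpos P hP
                  gcongr
                  exact Real.self_le_rpow_of_one_le hD hp
              _ = (D * t) ^ p * ∑ x ∈ P, w x := by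
                  rw [Real.mul_rpow (by linarith) ht.le]; ring
          have hmean : ‖weightedMean w P f‖ ≤ D * t := by
            refine (Real.rpow_le_rpow_iff (norm_nonneg _) (by positivity)
              (by linarith : 0 < p)).1 ?_
            refine (norm_weightedMean_rpow_le hw' (hpos P hP) hp f).trans ?_
            rwa [div_le_iff₀ (hpos P hP)]
          refine ⟨(P : Set V).indicator fun _ => weightedMean w P f, ?_, ?_, ?_, ?_⟩
          · intro x hx
            exact Set.indicator_of_notMem (by simpa using hx) _
          · intro x
            by_cases hx : x ∈ (P : Set V)
            · rwa [Set.indicator_of_mem hx]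
            · rw [Set.indicator_of_notMem hx, norm_zero]; positivity
          · rw [← sum_weight_mul_weightedMean (hpos P hP) f]
            exact Finset.sum_congr rfl fun x hx => by rw [Set.indicator_of_mem (by simpa using hx)]
          · rw [← Set.indicator_sub']
            change N ((P : Set V).indicator fun i => f i - weightedMean w P f) ≤ _
            have hin : ∀ x ∈ P, (P : Set V).indicator (fun i => f i - weightedMean w P f) x =
                f x - weightedMean w P f := fun x hx => Set.indicator_of_mem (by simpa using hx) _
            refine (hrec P hP1 hP2 _ (2 * D * t) (by positivity) ?_ ?_ ?_).trans ?_
            · intro x hx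
              exact Set.indicator_of_notMem (by simpa using hx) _
            · rw [Finset.sum_congr rfl fun x hx => by rw [hin x hx, mul_sub],
                Finset.sum_sub_distrib, sum_weight_mul_weightedMean (hpos P hP), sub_self]
            · rw [Finset.sum_congr rfl fun x hx => by rw [hin x hx]]
              refine (sum_weight_mul_norm_sub_weightedMean_rpow_le hw' (hpos P hP) hp f).trans ?_
              rw [show 2 * D * t = 2 * (D * t) by ring, Real.mul_rpow two_pos.le (by positivity),
                mul_assoc]
              gcongr
            -- The stopping condition bounds the mass of `P` by `t ^ (-p)` times the sum of `‖f‖ ^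
            -- p` over `P`; these bounds add up over disjoint stopping sets.
            · refine ENNReal.ofReal_le_ofReal ?_
              rw [mul_assoc (K * (2 * D * t))]
              refine mul_le_mul_of_nonneg_left ?_ (by positivity)
              rw [inv_mul_eq_div, le_div_iff₀ htp, mul_comm]
              exact hle.le
      choose! g hg0 hgb hgs hgN using hloc
      have hi0 : ∀ P ∈ s, ∀ x ∉ P, ((P : Set V).indicator f - g P) x = 0 := by
        intro P hP x hx
        rw [Pi.sub_apply, hg0 P hP x hx, Set.indicator_of_notMem (by simpa using hx), sub_zero]
      have hout : ∀ x ∉ Q, ∀ P ∈ s, x ∉ P := fun x hx P hP h => hx ((hmem x).2 ⟨P, hP, h⟩)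
      refine ⟨∑ P ∈ s, g P, ?_, ?_, ?_, ?_⟩
      · intro x hx
        rw [Finset.sum_apply]
        exact Finset.sum_eq_zero fun P hP => hg0 P hP x (hout x hx P hP)
      · intro x
        by_cases hx : x ∈ Q
        · obtain ⟨P, hP, hxP⟩ := (hmem x).1 hx
          rw [sum_apply_of_mem hdisj hg0 hP hxP]
          exact hgb P hP x
        · rw [Finset.sum_apply,
            Finset.sum_eq_zero fun P hP => hg0 P hP x (hout x hx P hP), norm_zero]
          positivity
      · rw [sum_eq_sum_sum hdisj hmem, sum_eq_sum_sum hdisj hmem]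
        refine Finset.sum_congr rfl fun P hP => ?_
        rw [← hgs P hP]
        exact Finset.sum_congr rfl fun x hx => by rw [sum_apply_of_mem hdisj hg0 hP hx]
      · have heq : (Q : Set V).indicator f - ∑ P ∈ s, g P =
            ∑ P ∈ s, ((P : Set V).indicator f - g P) := by
          ext x
          by_cases hx : x ∈ Q
          · obtain ⟨P, hP, hxP⟩ := (hmem x).1 hx
            rw [sum_apply_of_mem hdisj hi0 hP hxP, Pi.sub_apply, Pi.sub_apply,
              sum_apply_of_mem hdisj hg0 hP hxP, Set.indicator_of_mem (by simpa using hx),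
              Set.indicator_of_mem (by simpa using hxP)]
          · rw [Pi.sub_apply, Finset.sum_apply, Finset.sum_apply,
              Set.indicator_of_notMem (by simpa using hx),
              Finset.sum_eq_zero fun P hP => hg0 P hP x (hout x hx P hP),
              Finset.sum_eq_zero fun P hP => hi0 P hP x (hout x hx P hP), sub_zero]
        rw [heq]
        refine (Finset.le_sum_of_subadditive N hN0.le hNadd s _).trans ((Finset.sum_le_sum hgN).trans ?_)
        rw [← ENNReal.ofReal_sum_of_nonneg fun P _ => mul_nonneg hc (hsum0 P), ← Finset.mul_sum,
          sum_eq_sum_sum hdisj hmem]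

/-- Mean-zero functions are controlled by their `L^p`-averages, as soon as bounded ones are. -/
theorem exists_gaugeLe {w : V → ℝ} (hw : ∀ x, 0 < w x) {𝓑 : Set (Finset V)} {D B : ℝ}
    (hD : 1 ≤ D) (hB : 0 < B) (h𝓑 : IsRegularSplitting w 𝓑 D)
    (hpos : ∀ Q ∈ 𝓑, 0 < ∑ x ∈ Q, w x) {N : (V → ℂ) → ℝ≥0∞}
    (hN0 : N 0 = 0) (hNadd : ∀ f g, N (f + g) ≤ N f + N g)
    (hNb : ∀ Q ∈ 𝓑, ∀ (g : V → ℂ) (b : ℝ), 0 < b → (∀ x ∉ Q, g x = 0) → (∀ x, ‖g x‖ ≤ b) →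
      ∑ x ∈ Q, (w x : ℂ) * g x = 0 → N g ≤ ENNReal.ofReal (B * b * ∑ x ∈ Q, w x))
    {p : ℝ} (hp : 1 < p) : ∃ K : ℝ, 0 < K ∧ ∀ Q ∈ 𝓑, GaugeLe w N p K Q := by
  -- Stopping at height `l * s`, the remainder costs `2 * D * l / l ^ p` times the constant being
  -- proved. The choice `l ^ (p - 1) = 4 * D` makes this factor `1 / 2`.
  set l : ℝ := (4 * D) ^ (1 / (p - 1)) with hl
  have hl1 : 1 ≤ l := Real.one_le_rpow (by linarith) (by apply one_div_nonneg.2; linarith)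
  have hl0 : 0 < l := by linarith
  have hlp : l ^ p = 4 * D * l := by
    have : l ^ (p - 1) = 4 * D := by
      rw [hl, ← Real.rpow_mul (by linarith), one_div_mul_cancel (by linarith), Real.rpow_one]
    rw [← this, ← Real.rpow_add_one hl0.ne', sub_add_cancel]
  have hlp0 : 0 < l ^ p := Real.rpow_pos_of_pos hl0 p
  -- The bounded part costs `B * D * l`, which is the other half of this constant.
  refine ⟨2 * B * D * l, by positivity, fun Q => ?_⟩
  induction Q using Finset.strongInduction with
  | H Q ih =>
    intro hQ u s hs hu0 hum hus
    have hQ0 := hpos Q hQ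
    have hsp : 0 < s ^ p := Real.rpow_pos_of_pos hs p
    obtain ⟨g, hg0, hgb, hgs, hgN⟩ := exists_bounded_part hw hD h𝓑 hN0 hNadd hp.le
      (t := l * s) (by positivity) (by positivity : 0 ≤ 2 * B * D * l) u Q hQ hQ0
      (fun P hP hPQ => ih P hPQ hP) (hus.trans (by
        gcongr
        nlinarith))
    have hind : (Q : Set V).indicator u = u := by
      refine Set.indicator_eq_self.2 fun x hx => ?_
      by_contra hx'
      exact hx (hu0 x (by simpa using hx'))
    rw [hind] at hgN
    have h1 := hNb Q hQ g (D * (l * s)) (by positivity) hg0 hgb (hgs.trans hum)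
    calc N u = N (g + (u - g)) := by rw [add_sub_cancel]
      _ ≤ N g + N (u - g) := hNadd _ _
      _ ≤ _ := add_le_add h1 hgN
      _ = ENNReal.ofReal (B * (D * (l * s)) * ∑ x ∈ Q, w x + 2 * B * D * l *
            (2 * D * (l * s)) * ((l * s) ^ p)⁻¹ * ∑ x ∈ Q, w x * ‖u x‖ ^ p) := by
          rw [ENNReal.ofReal_add (by positivity)]
          exact mul_nonneg (by positivity) (Finset.sum_nonneg fun x _ =>
            mul_nonneg (hw x).le (Real.rpow_nonneg (norm_nonneg _) _))
      _ ≤ ENNReal.ofReal (2 * B * D * l * s * ∑ x ∈ Q, w x) := by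
          refine ENNReal.ofReal_le_ofReal ?_
          calc _ ≤ B * (D * (l * s)) * ∑ x ∈ Q, w x + 2 * B * D * l *
                (2 * D * (l * s)) * ((l * s) ^ p)⁻¹ * (s ^ p * ∑ x ∈ Q, w x) := by gcongr
            _ = 2 * B * D * l * s * ∑ x ∈ Q, w x := by
                rw [Real.mul_rpow hl0.le hs.le, hlp]
                field_simp
                ring

end Splitting

namespace WeightedTree

noncomputable section

variable {V : Type*} {m : ℕ}

/-! The family of boxes. -/

/-- The boxes that are comparable to Calderón–Zygmund sets. -/
def boxes (T : WeightedTree V m) : Set (Finset V) :=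
  {Q | ∃ x a n, (a = 0 ∧ n = 1 ∨ 0 < n ∧ n ≤ 7 * a ∧ a ≤ 2 * n) ∧ Q = T.box x a n}

theorem box_zero_one (T : WeightedTree V m) (x : V) : T.box x 0 1 = {x} := by
  simp [box, descendants]

theorem exists_mem_boxes_of_mem_czSets (T : WeightedTree V m) {R : Set V} (hR : R ∈ T.czSets) :
    ∃ Q ∈ T.boxes, R = Q := by
  rcases hR with ⟨x, rfl⟩ | ⟨x, h, hh, rfl⟩
  · exact ⟨_, ⟨x, 0, 1, Or.inl ⟨rfl, rfl⟩, rfl⟩, by simp [box_zero_one]⟩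
  · exact ⟨_, ⟨x, (h + 1) / 2, 4 * h - (h + 1) / 2, Or.inr (by omega), rfl⟩,
      T.trapezoid_eq_box x h⟩

theorem sum_weight_pos (hm : 2 ≤ m) (T : WeightedTree V m) {Q : Finset V} (hQ : Q ∈ T.boxes) :
    0 < ∑ x ∈ Q, T.weight x := by
  obtain ⟨x, a, n, h, rfl⟩ := hQ
  rw [T.sum_weight_box hm]
  have : (0 : ℝ) < n := by exact_mod_cast (by omega : 0 < n)
  exact mul_pos this (T.weight_pos hm x)

/-- The Calderón–Zygmund set with root `x` and `h = 2 * a` occupies the depths from `a` to `8 * a -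
1`. It contains the box because `n ≤ 7 * a`, and `a ≤ 2 * n` bounds the ratio of masses by `14`. -/
theorem exists_czSet_superset (hm : 2 ≤ m) (T : WeightedTree V m) {Q : Finset V}
    (hQ : Q ∈ T.boxes) : ∃ R : Finset V, (R : Set V) ∈ T.czSets ∧ Q ⊆ R ∧
      ∑ x ∈ R, T.weight x ≤ 14 * ∑ x ∈ Q, T.weight x := by
  have hpos := T.sum_weight_pos hm hQ
  obtain ⟨x, a, n, ⟨rfl, rfl⟩ | h, rfl⟩ := hQ
  · refine ⟨_, Or.inl ⟨x, ?_⟩, subset_rfl, by linarith⟩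
    simp [box_zero_one]
  · refine ⟨T.box x a (7 * a), Or.inr ⟨x, 2 * a, by omega, ?_⟩, fun y hy => ?_, ?_⟩
    · rw [trapezoid_eq_box]
      congr <;> omega
    · obtain ⟨k, h1, h2, h3⟩ := T.mem_box.1 hy
      exact T.mem_box.2 ⟨k, h1, by omega, h3⟩
    · rw [T.sum_weight_box hm, T.sum_weight_box hm, ← mul_assoc]
      refine mul_le_mul_of_nonneg_right ?_ (T.weight_pos hm x).le
      exact_mod_cast (by omega : 7 * a ≤ 14 * n)

theorem ssubset_of_sum_weight_lt (T : WeightedTree V m) {P Q : Finset V} (h : P ⊆ Q)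
    (hlt : ∑ x ∈ P, T.weight x < ∑ x ∈ Q, T.weight x) : P ⊂ Q :=
  h.ssubset_of_ne fun h' => by rw [h'] at hlt; exact lt_irrefl _ hlt

/-- A box far enough below its root is cut into boxes rooted at the children, with mass ratio `m`.
Otherwise its range of levels is halved, with ratio at most `3`. Both are at most `m + 1` since `m ≥
2`. -/
theorem isRegularSplitting_boxes (hm : 2 ≤ m) (T : WeightedTree V m) :
    IsRegularSplitting T.weight T.boxes (m + 1) := by
  classical
  have hm' : (2 : ℝ) ≤ m := by exact_mod_cast hm
  rintro _ ⟨x, a, n, h, rfl⟩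
  have hx := T.weight_pos hm x
  by_cases h0 : a = 0
  · left
    exact ⟨x, by rw [h0, show n = 1 by omega, box_zero_one]⟩
  right
  have hn : 0 < n := by omega
  have hn' : (1 : ℝ) ≤ n := by exact_mod_cast hn
  -- The condition under which the pieces rooted at the children are again admissible; `n = 1`
  -- covers the boxes that become singletons when `a = 1`.
  by_cases hv : n ≤ 7 * (a - 1) ∨ n = 1
  · refine ⟨(T.children x).image fun z => T.box z (a - 1) n, ?_, ?_, ?_⟩
    · intro P hP
      obtain ⟨z, hz, rfl⟩ := Finset.mem_image.1 hP
      rw [mem_children] at hz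
      have hxz := T.weight_of_parent_eq hm hz
      have hz0 := T.weight_pos hm z
      refine ⟨⟨z, a - 1, n, by omega, rfl⟩, T.ssubset_of_sum_weight_lt ?_ ?_, ?_⟩
      · intro y hy
        obtain ⟨k, h1, h2, h3⟩ := T.mem_box.1 hy
        exact T.mem_box.2 ⟨k + 1, by omega, by omega, by
          rw [Function.iterate_succ_apply', h3, hz]⟩
      · rw [T.sum_weight_box hm, T.sum_weight_box hm, hxz]
        refine mul_lt_mul_of_pos_left ?_ (by linarith)
        nlinarith
      · rw [T.sum_weight_box hm, T.sum_weight_box hm, hxz]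
        nlinarith [mul_pos (by linarith : (0 : ℝ) < n) hz0]
    · intro P hP P' hP' y hy hy'
      obtain ⟨z, hz, rfl⟩ := Finset.mem_image.1 hP
      obtain ⟨z', hz', rfl⟩ := Finset.mem_image.1 hP'
      rw [mem_children] at hz hz'
      obtain ⟨k, -, -, hk⟩ := T.mem_box.1 hy
      obtain ⟨k', -, -, hk'⟩ := T.mem_box.1 hy'
      have h1 := T.level_parent z
      have h2 := T.level_parent z'
      rw [hz] at h1
      rw [hz'] at h2
      have := T.eq_of_iterate_parent_eq hk hk' (by linarith)
      subst this
      rw [← hk, ← hk']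
    · intro y
      simp only [Finset.mem_image, exists_exists_and_eq_and, mem_children, mem_box]
      constructor
      · rintro ⟨k, h1, h2, h3⟩
        obtain ⟨k, rfl⟩ : ∃ l, k = l + 1 := ⟨k - 1, by omega⟩
        rw [Function.iterate_succ_apply'] at h3
        exact ⟨_, h3, k, by omega, by omega, rfl⟩
      · rintro ⟨z, hz, k, h1, h2, h3⟩
        exact ⟨k + 1, by omega, by omega, by rw [Function.iterate_succ_apply', h3, hz]⟩
  -- Here `n ≥ 2` and `n > 7 * (a - 1)`, so both halves are nonempty and remain admissible; the
  -- ratio `3` is attained at `n = 3`.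
  · have hc : (n : ℝ) = (n / 2 : ℕ) + (n - n / 2 : ℕ) := by
      rw [← Nat.cast_add]; congr 1; omega
    have e1 : (0 : ℝ) < (n / 2 : ℕ) := by exact_mod_cast (by omega : 0 < n / 2)
    have e2 : (0 : ℝ) < (n - n / 2 : ℕ) := by exact_mod_cast (by omega : 0 < n - n / 2)
    have e3 : (n : ℝ) ≤ 3 * (n / 2 : ℕ) := by exact_mod_cast (by omega : n ≤ 3 * (n / 2))
    have e4 : (n : ℝ) ≤ 3 * (n - n / 2 : ℕ) := by
      exact_mod_cast (by omega : n ≤ 3 * (n - n / 2))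
    refine ⟨{T.box x a (n / 2), T.box x (a + n / 2) (n - n / 2)}, ?_, ?_, ?_⟩
    · intro P hP
      simp only [Finset.mem_insert, Finset.mem_singleton] at hP
      rcases hP with rfl | rfl
      · refine ⟨⟨x, _, _, by omega, rfl⟩, T.ssubset_of_sum_weight_lt ?_ ?_, ?_⟩
        · intro y hy
          obtain ⟨k, h1, h2, h3⟩ := T.mem_box.1 hy
          exact T.mem_box.2 ⟨k, by omega, by omega, h3⟩
        · rw [T.sum_weight_box hm, T.sum_weight_box hm]
          exact mul_lt_mul_of_pos_right (by linarith) hx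
        · rw [T.sum_weight_box hm, T.sum_weight_box hm, ← mul_assoc]
          exact mul_le_mul_of_nonneg_right (by nlinarith) hx.le
      · refine ⟨⟨x, _, _, by omega, rfl⟩, T.ssubset_of_sum_weight_lt ?_ ?_, ?_⟩
        · intro y hy
          obtain ⟨k, h1, h2, h3⟩ := T.mem_box.1 hy
          exact T.mem_box.2 ⟨k, by omega, by omega, h3⟩
        · rw [T.sum_weight_box hm, T.sum_weight_box hm]
          exact mul_lt_mul_of_pos_right (by linarith) hx
        · rw [T.sum_weight_box hm, T.sum_weight_box hm, ← mul_assoc]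
          exact mul_le_mul_of_nonneg_right (by nlinarith) hx.le
    · have hdis : ∀ y ∈ T.box x a (n / 2), y ∉ T.box x (a + n / 2) (n - n / 2) := by
        intro y hy hy'
        obtain ⟨k, h1, h2, h3⟩ := T.mem_box.1 hy
        obtain ⟨k', h1', h2', h3'⟩ := T.mem_box.1 hy'
        have := T.eq_of_iterate_parent_eq h3 h3' rfl
        omega
      intro P hP P' hP' y hy hy'
      simp only [Finset.mem_insert, Finset.mem_singleton] at hP hP'
      rcases hP with rfl | rfl <;> rcases hP' with rfl | rfl
      · rfl
      · exact absurd hy' (hdis y hy)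
      · exact absurd hy (hdis y hy')
      · rfl
    · intro y
      simp only [Finset.mem_insert, Finset.mem_singleton, exists_eq_or_imp, exists_eq_left,
        mem_box]
      constructor
      · rintro ⟨k, h1, h2, h3⟩
        by_cases hk : k < a + n / 2
        · exact Or.inl ⟨k, h1, hk, h3⟩
        · exact Or.inr ⟨k, by omega, by omega, h3⟩
      · rintro (⟨k, h1, h2, h3⟩ | ⟨k, h1, h2, h3⟩)
        · exact ⟨k, h1, by omega, h3⟩
        · exact ⟨k, by omega, by omega, h3⟩

theorem sum_weight_mul_rpow_nonneg (hm : 2 ≤ m) (T : WeightedTree V m) (Q : Finset V) (q : ℝ)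
    (f : V → ℂ) : 0 ≤ ∑ x ∈ Q, T.weight x * ‖f x‖ ^ q :=
  Finset.sum_nonneg fun x _ => mul_nonneg (T.weight_pos hm x).le
    (Real.rpow_nonneg (norm_nonneg _) _)

/-! Integrals of finitely supported functions. -/

variable [MeasurableSpace V] [DiscreteMeasurableSpace V]

theorem μ_singleton (T : WeightedTree V m) (x : V) :
    T.μ {x} = ENNReal.ofReal (T.weight x) := by
  rw [μ, withDensity_apply _ MeasurableSet.of_discrete, lintegral_singleton, Measure.count_singleton,
    mul_one, weight, ← ENNReal.ofReal_coe_nnreal]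
  simp

theorem μ_pos (hm : 2 ≤ m) (T : WeightedTree V m) (x : V) : 0 < T.μ {x} := by
  rw [μ_singleton]
  exact ENNReal.ofReal_pos.2 (T.weight_pos hm x)

theorem lintegral_finset_eq (T : WeightedTree V m) (Q : Finset V) (F : V → ℝ≥0∞) :
    ∫⁻ x in (Q : Set V), F x ∂T.μ = ∑ x ∈ Q, ENNReal.ofReal (T.weight x) * F x := by
  rw [lintegral_finset]
  exact Finset.sum_congr rfl fun x _ => by rw [μ_singleton, mul_comm]

theorem μ_finset (hm : 2 ≤ m) (T : WeightedTree V m) (Q : Finset V) :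
    T.μ Q = ENNReal.ofReal (∑ x ∈ Q, T.weight x) := by
  rw [← setLIntegral_one, lintegral_finset_eq,
    ENNReal.ofReal_sum_of_nonneg fun x _ => (T.weight_pos hm x).le]
  simp

theorem setIntegral_finset (hm : 2 ≤ m) (T : WeightedTree V m) (Q : Finset V) (f : V → ℂ) :
    ∫ x in (Q : Set V), f x ∂T.μ = ∑ x ∈ Q, (T.weight x : ℂ) * f x := by
  rw [MeasureTheory.setIntegral_finset Q (T.integrableOn_finite Q.finite_toSet f)]
  refine Finset.sum_congr rfl fun x _ => ?_
  rw [Measure.real, μ_singleton, ENNReal.toReal_ofReal (T.weight_pos hm x).le, Complex.real_smul]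

theorem integral_eq_sum (hm : 2 ≤ m) (T : WeightedTree V m) {Q : Finset V} {f : V → ℂ}
    (hf : ∀ x ∉ Q, f x = 0) : ∫ x, f x ∂T.μ = ∑ x ∈ Q, (T.weight x : ℂ) * f x := by
  rw [← T.setIntegral_finset hm, setIntegral_eq_integral_of_forall_compl_eq_zero]
  exact fun x hx => hf x (by simpa using hx)

theorem setAverage_finset (hm : 2 ≤ m) (T : WeightedTree V m) (Q : Finset V) (f : V → ℂ) :
    ⨍ x in (Q : Set V), f x ∂T.μ = weightedMean T.weight Q f := by
  rw [setAverage_eq, T.setIntegral_finset hm, Measure.real, T.μ_finset hm,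
    ENNReal.toReal_ofReal (Finset.sum_nonneg fun x _ => (T.weight_pos hm x).le), weightedMean,
    Complex.real_smul, Complex.ofReal_inv, inv_mul_eq_div]

theorem lintegral_enorm_rpow_finset (hm : 2 ≤ m) (T : WeightedTree V m) (Q : Finset V) {q : ℝ}
    (hq : 0 ≤ q) (f : V → ℂ) : ∫⁻ x in (Q : Set V), ‖f x‖ₑ ^ q ∂T.μ =
      ENNReal.ofReal (∑ x ∈ Q, T.weight x * ‖f x‖ ^ q) := by
  rw [lintegral_finset_eq, ENNReal.ofReal_sum_of_nonneg fun x _ => mul_nonneg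
    (T.weight_pos hm x).le (Real.rpow_nonneg (norm_nonneg _) _)]
  refine Finset.sum_congr rfl fun x _ => ?_
  rw [ENNReal.ofReal_mul (T.weight_pos hm x).le, ← ENNReal.ofReal_rpow_of_nonneg (norm_nonneg _) hq,
    ofReal_norm]

theorem osc_finset (hm : 2 ≤ m) (T : WeightedTree V m) {Q : Finset V}
    (hQ : 0 < ∑ x ∈ Q, T.weight x) {q : ℝ} (hq : 0 < q) (f : V → ℂ) :
    T.osc q f Q = ENNReal.ofReal (((∑ x ∈ Q, T.weight x *
      ‖f x - weightedMean T.weight Q f‖ ^ q) / ∑ x ∈ Q, T.weight x) ^ (1 / q)) := by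
  rw [osc, T.setAverage_finset hm,
    T.lintegral_enorm_rpow_finset hm Q hq.le (fun x => f x - weightedMean T.weight Q f),
    T.μ_finset hm, ← ENNReal.ofReal_inv_of_pos hQ, ← ENNReal.ofReal_mul (inv_nonneg.2 hQ.le),
    inv_mul_eq_div, ENNReal.ofReal_rpow_of_nonneg _ (by positivity)]
  exact div_nonneg (T.sum_weight_mul_rpow_nonneg hm Q q
    fun x => f x - weightedMean T.weight Q f) hQ.le

end

end WeightedTree

namespace WeightedTree

noncomputable section

variable {V : Type*} {m : ℕ} [MeasurableSpace V]

/-! The gauge of the Hardy space. -/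

theorem hardyNorm_le {T : WeightedTree V m} {p : ℝ≥0∞} {g : V → ℂ} {c : ℕ → ℂ}
    {a : ℕ → V → ℂ} (h : T.IsAtomicDecomposition p g c a) : T.hardyNorm p g ≤ ∑' j, ‖c j‖ₑ :=
  iInf_le_of_le c (iInf_le_of_le a (iInf_le_of_le h le_rfl))

theorem le_mul_hardyNorm {T : WeightedTree V m} {p : ℝ≥0∞} {g : V → ℂ} {b r : ℝ≥0∞} (hb : b ≠ 0)
    (hb' : b ≠ ∞) (h : ∀ c a, T.IsAtomicDecomposition p g c a → r ≤ b * ∑' j, ‖c j‖ₑ) :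
    r ≤ b * T.hardyNorm p g := by
  rw [hardyNorm, ENNReal.mul_iInf_of_ne hb hb']
  refine le_iInf fun c => ?_
  rw [ENNReal.mul_iInf_of_ne hb hb']
  refine le_iInf fun a => ?_
  rw [ENNReal.mul_iInf_of_ne hb hb']
  exact le_iInf fun hd => h c a hd

theorem exists_decomposition {T : WeightedTree V m} {p : ℝ≥0∞} {g : V → ℂ} {r : ℝ≥0∞}
    (h : T.hardyNorm p g < r) : ∃ c a, T.IsAtomicDecomposition p g c a ∧ ∑' j, ‖c j‖ₑ < r := by
  simp only [hardyNorm, iInf_lt_iff] at h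
  obtain ⟨c, a, h1, h2⟩ := h
  exact ⟨c, a, h1, h2⟩

theorem hardyNorm_zero (T : WeightedTree V m) (p : ℝ≥0∞) : T.hardyNorm p 0 = 0 := by
  have h : T.IsAtomicDecomposition p 0 (fun _ => 0) (fun _ => 0) :=
    ⟨fun _ => T.isAtom_zero p, by simp, fun x => by simp⟩
  exact le_antisymm ((hardyNorm_le h).trans (by simp)) bot_le

theorem hardyNorm_smul_atom_le {T : WeightedTree V m} {p : ℝ≥0∞} {a : V → ℂ}
    (h : T.IsAtom p a) (c : ℂ) : T.hardyNorm p (fun x => c * a x) ≤ ‖c‖ₑ := by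
  have h0 : ∀ j ∉ ({0} : Finset ℕ), (if j = 0 then c else 0) = 0 := fun j hj =>
    if_neg (by simpa using hj)
  have hd : T.IsAtomicDecomposition p (fun x => c * a x) (fun j => if j = 0 then c else 0)
      (fun _ => a) := by
    refine ⟨fun _ => h, summable_of_ne_finset_zero (s := {0}) fun j hj => by simp [h0 j hj],
      fun x => ?_⟩
    have : HasSum (fun j => (if j = 0 then c else 0) * a x)
        (∑ j ∈ ({0} : Finset ℕ), (if j = 0 then c else 0) * a x) :=
      hasSum_sum_of_ne_finset_zero fun j hj => by rw [h0 j hj, zero_mul]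
    simpa using this
  refine (hardyNorm_le hd).trans ((tsum_eq_sum (s := {0}) fun j hj => ?_).le.trans ?_)
  · rw [h0 j hj, enorm_zero]
  · simp

theorem hardyNorm_smul_le (T : WeightedTree V m) (p : ℝ≥0∞) (c : ℂ) (g : V → ℂ) :
    T.hardyNorm p (fun x => c * g x) ≤ ‖c‖ₑ * T.hardyNorm p g := by
  by_cases hc : c = 0
  · have := T.hardyNorm_zero p
    simp only [hc, zero_mul, enorm_zero]
    exact this.le
  · refine le_mul_hardyNorm (by simpa using hc) enorm_ne_top fun c' a h => ?_
    have hd : T.IsAtomicDecomposition p (fun x => c * g x) (fun j => c * c' j) a := by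
      refine ⟨h.1, ?_, fun x => ?_⟩
      · simpa only [norm_mul] using h.2.1.mul_left ‖c‖
      · simpa only [mul_assoc] using (h.2.2 x).mul_left c
    refine (hardyNorm_le hd).trans (le_of_eq ?_)
    rw [← ENNReal.tsum_mul_left]
    exact tsum_congr fun j => enorm_mul _ _

theorem tsum_enorm_lt_top_of_decomposition {T : WeightedTree V m} {p : ℝ≥0∞} {g : V → ℂ}
    {c : ℕ → ℂ} {a : ℕ → V → ℂ} (h : T.IsAtomicDecomposition p g c a) : ∑' j, ‖c j‖ₑ < ∞ :=
  lt_top_iff_ne_top.2 (tsum_enorm_ne_top_iff_summable_norm.2 h.2.1)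

variable [DiscreteMeasurableSpace V]

/-! Atoms. -/

theorem forall_of_ae (hm : 2 ≤ m) (T : WeightedTree V m) {P : V → Prop} (h : ∀ᵐ x ∂T.μ, P x)
    (x : V) : P x := by
  by_contra hx
  have h1 : T.μ {x} ≤ T.μ {y | ¬ P y} := measure_mono (by simpa using hx)
  exact (T.μ_pos hm x).ne' (le_antisymm (h1.trans (ae_iff.1 h).le) bot_le)

theorem eLpNorm_eq (hm : 2 ≤ m) (T : WeightedTree V m) {Q : Finset V} {p : ℝ} (hp : 0 < p)
    {a : V → ℂ} (ha : ∀ x ∉ Q, a x = 0) : eLpNorm a (ENNReal.ofReal p) T.μ =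
      ENNReal.ofReal ((∑ x ∈ Q, T.weight x * ‖a x‖ ^ p) ^ (1 / p)) := by
  rw [eLpNorm_eq_lintegral_rpow_enorm_toReal (by simpa using hp) ENNReal.ofReal_ne_top,
    ENNReal.toReal_ofReal hp.le, ← ENNReal.ofReal_rpow_of_nonneg
    (T.sum_weight_mul_rpow_nonneg hm Q p a) (by positivity),
    ← T.lintegral_enorm_rpow_finset hm Q hp.le, setLIntegral_eq_of_support_subset]
  intro x hx
  by_contra hxQ
  simp [ha x (by simpa using hxQ), hp] at hx

/-- The size condition takes the form used in `GaugeLe`, with `s` the inverse of the mass of `Q`. -/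
theorem isAtom_ofReal_iff (hm : 2 ≤ m) (T : WeightedTree V m) {p : ℝ} (hp : 0 < p) {a : V → ℂ} :
    T.IsAtom (ENNReal.ofReal p) a ↔ ∃ Q : Finset V, Q ∈ T.boxes ∧ (Q : Set V) ∈ T.czSets ∧
      (∀ x ∉ Q, a x = 0) ∧ ∑ x ∈ Q, (T.weight x : ℂ) * a x = 0 ∧
      ∑ x ∈ Q, T.weight x * ‖a x‖ ^ p ≤
        ((∑ x ∈ Q, T.weight x)⁻¹) ^ p * ∑ x ∈ Q, T.weight x := by
  have key : ∀ Q ∈ T.boxes, (∀ x ∉ Q, a x = 0) →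
      (eLpNorm a (ENNReal.ofReal p) T.μ ≤ T.μ Q ^ (((ENNReal.ofReal p)⁻¹).toReal - 1) ↔
      ∑ x ∈ Q, T.weight x * ‖a x‖ ^ p ≤
        ((∑ x ∈ Q, T.weight x)⁻¹) ^ p * ∑ x ∈ Q, T.weight x) := by
    intro Q hQ ha
    have hpos := T.sum_weight_pos hm hQ
    rw [T.eLpNorm_eq hm hp ha, ENNReal.toReal_inv, ENNReal.toReal_ofReal hp.le, T.μ_finset hm,
      ENNReal.ofReal_rpow_of_pos hpos, ENNReal.ofReal_le_ofReal_iff (by positivity)]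
    have h1 : (∑ x ∈ Q, T.weight x) ^ (p⁻¹ - 1) =
        (((∑ x ∈ Q, T.weight x)⁻¹) ^ p * ∑ x ∈ Q, T.weight x) ^ (1 / p) := by
      rw [← Real.rpow_neg_one (∑ x ∈ Q, T.weight x), ← Real.rpow_mul hpos.le, ← Real.rpow_add_one hpos.ne',
        ← Real.rpow_mul hpos.le]
      congr 1
      field_simp
      ring
    rw [h1]
    exact Real.rpow_le_rpow_iff (T.sum_weight_mul_rpow_nonneg hm Q p a) (by positivity)
      (by positivity)
  constructor
  · rintro ⟨R, hR, hsupp, hn, hi⟩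
    obtain ⟨Q, hQ, rfl⟩ := T.exists_mem_boxes_of_mem_czSets hR
    have ha : ∀ x ∉ Q, a x = 0 := fun x hx => by
      by_contra h
      exact hx (by simpa using hsupp h)
    exact ⟨Q, hQ, hR, ha, by rwa [← T.integral_eq_sum hm ha], (key Q hQ ha).1 hn⟩
  · rintro ⟨Q, hQ, hR, ha, hi, hn⟩
    refine ⟨Q, hR, fun x hx => ?_, (key Q hQ ha).2 hn, by rwa [T.integral_eq_sum hm ha]⟩
    by_contra h
    exact hx (ha x (by simpa using h))

theorem isAtom_top_iff (hm : 2 ≤ m) (T : WeightedTree V m) {a : V → ℂ} :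
    T.IsAtom ∞ a ↔ ∃ Q : Finset V, Q ∈ T.boxes ∧ (Q : Set V) ∈ T.czSets ∧
      (∀ x ∉ Q, a x = 0) ∧ ∑ x ∈ Q, (T.weight x : ℂ) * a x = 0 ∧
      ∀ x, ‖a x‖ ≤ (∑ x ∈ Q, T.weight x)⁻¹ := by
  have key : ∀ Q ∈ T.boxes, (eLpNorm a ∞ T.μ ≤ T.μ Q ^ (((∞ : ℝ≥0∞)⁻¹).toReal - 1) ↔
      ∀ x, ‖a x‖ ≤ (∑ x ∈ Q, T.weight x)⁻¹) := by
    intro Q hQ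
    have hpos := T.sum_weight_pos hm hQ
    have h1 : T.μ Q ^ (((∞ : ℝ≥0∞)⁻¹).toReal - 1) =
        ENNReal.ofReal (∑ x ∈ Q, T.weight x)⁻¹ := by
      rw [T.μ_finset hm, ENNReal.ofReal_rpow_of_pos hpos]
      simp [Real.rpow_neg_one]
    have h2 : ∀ x, ‖a x‖ₑ ≤ ENNReal.ofReal (∑ x ∈ Q, T.weight x)⁻¹ ↔
        ‖a x‖ ≤ (∑ x ∈ Q, T.weight x)⁻¹ := fun x => by
      rw [← ofReal_norm, ENNReal.ofReal_le_ofReal_iff (inv_nonneg.2 hpos.le)]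
    rw [h1, eLpNorm_exponent_top]
    constructor
    · intro h x
      exact (h2 x).1 ((T.forall_of_ae hm (enorm_ae_le_eLpNormEssSup a T.μ) x).trans h)
    · intro h
      exact eLpNormEssSup_le_of_ae_enorm_bound (Filter.Eventually.of_forall fun x => (h2 x).2 (h x))
  constructor
  · rintro ⟨R, hR, hsupp, hn, hi⟩
    obtain ⟨Q, hQ, rfl⟩ := T.exists_mem_boxes_of_mem_czSets hR
    have ha : ∀ x ∉ Q, a x = 0 := fun x hx => by
      by_contra h
      exact hx (by simpa using hsupp h)
    exact ⟨Q, hQ, hR, ha, by rwa [← T.integral_eq_sum hm ha], (key Q hQ).1 hn⟩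
  · rintro ⟨Q, hQ, hR, ha, hi, hn⟩
    refine ⟨Q, hR, fun x hx => ?_, (key Q hQ).2 hn, by rwa [T.integral_eq_sum hm ha]⟩
    by_contra h
    exact hx (ha x (by simpa using h))

theorem IsAtom.ofReal_of_top (hm : 2 ≤ m) {T : WeightedTree V m} {p : ℝ} (hp : 0 < p)
    {a : V → ℂ} (h : T.IsAtom ∞ a) : T.IsAtom (ENNReal.ofReal p) a := by
  obtain ⟨Q, hQ, hR, ha, hi, hn⟩ := (T.isAtom_top_iff hm).1 h
  refine (T.isAtom_ofReal_iff hm hp).2 ⟨Q, hQ, hR, ha, hi, ?_⟩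
  rw [Finset.mul_sum]
  refine Finset.sum_le_sum fun x _ => ?_
  rw [mul_comm]
  exact mul_le_mul_of_nonneg_right (Real.rpow_le_rpow (norm_nonneg _) (hn x) hp.le)
    (T.weight_pos hm x).le

/-- A bound at `x` uniform over all atoms makes atomic series converge absolutely at each vertex, so
that double series can be rearranged. -/
theorem IsAtom.norm_le (hm : 2 ≤ m) {T : WeightedTree V m} {a : V → ℂ} (h : T.IsAtom ∞ a)
    (x : V) : ‖a x‖ ≤ (T.weight x)⁻¹ := by
  obtain ⟨Q, hQ, hR, ha, hi, hn⟩ := (T.isAtom_top_iff hm).1 h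
  by_cases hx : x ∈ Q
  · refine (hn x).trans (inv_anti₀ (T.weight_pos hm x) ?_)
    exact Finset.single_le_sum (f := T.weight) (fun y _ => (T.weight_pos hm y).le) hx
  · rw [ha x hx, norm_zero]
    exact inv_nonneg.2 (T.weight_pos hm x).le

/-- The norm of `H^{1,∞}(μ)` is countably subadditive. -/
theorem hardyNorm_le_tsum (hm : 2 ≤ m) (T : WeightedTree V m) {g : V → ℂ} {G : ℕ → V → ℂ}
    (h : ∀ x, HasSum (fun j => G j x) (g x)) : T.hardyNorm ∞ g ≤ ∑' j, T.hardyNorm ∞ (G j) := by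
  refine ENNReal.le_of_forall_pos_le_add fun ε hε htop => ?_
  obtain ⟨δ, hδ, hδε⟩ := ENNReal.exists_pos_sum_of_countable
    (ENNReal.coe_ne_zero.2 hε.ne') ℕ
  have hlt : ∀ j, T.hardyNorm ∞ (G j) < T.hardyNorm ∞ (G j) + δ j := fun j =>
    ENNReal.lt_add_right (ENNReal.ne_top_of_tsum_ne_top htop.ne j)
      (ENNReal.coe_ne_zero.2 (hδ j).ne')
  choose c a hd hs using fun j => exists_decomposition (hlt j)
  have hle : ∑' i : ℕ × ℕ, ‖c i.1 i.2‖ₑ ≤ ∑' j, T.hardyNorm ∞ (G j) + ε := by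
    rw [ENNReal.tsum_prod (f := fun i j => ‖c i j‖ₑ)]
    refine (ENNReal.tsum_le_tsum fun j => (hs j).le).trans ?_
    rw [ENNReal.tsum_add]
    gcongr
  have hsum : Summable fun i : ℕ × ℕ => ‖c i.1 i.2‖ :=
    tsum_enorm_ne_top_iff_summable_norm.1
      (ne_top_of_le_ne_top (ENNReal.add_ne_top.2 ⟨htop.ne, ENNReal.coe_ne_top⟩) hle)
  have hx : ∀ x, HasSum (fun i : ℕ × ℕ => c i.1 i.2 * a i.1 i.2 x) (g x) := by
    intro x
    have h1 : Summable fun i : ℕ × ℕ => c i.1 i.2 * a i.1 i.2 x := by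
      refine Summable.of_norm_bounded (hsum.mul_right (T.weight x)⁻¹) fun i => ?_
      rw [norm_mul]
      exact mul_le_mul_of_nonneg_left (((hd i.1).1 i.2).norm_le hm x) (norm_nonneg _)
    have h2 := h1.hasSum.prod_fiberwise fun j => (hd j).2.2 x
    rw [(h x).unique h2]
    exact h1.hasSum
  let e : ℕ ≃ ℕ × ℕ := Nat.pairEquiv.symm
  have hD : T.IsAtomicDecomposition ∞ g (fun n => c (e n).1 (e n).2)
      (fun n => a (e n).1 (e n).2) :=
    ⟨fun n => (hd _).1 _, (e.summable_iff (f := fun i : ℕ × ℕ => ‖c i.1 i.2‖)).2 hsum,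
      fun x => (e.hasSum_iff (f := fun i : ℕ × ℕ => c i.1 i.2 * a i.1 i.2 x)).2 (hx x)⟩
  refine (hardyNorm_le hD).trans (le_trans (le_of_eq ?_) hle)
  exact e.tsum_eq fun i : ℕ × ℕ => ‖c i.1 i.2‖ₑ

theorem hardyNorm_add_le (hm : 2 ≤ m) (T : WeightedTree V m) (f g : V → ℂ) :
    T.hardyNorm ∞ (f + g) ≤ T.hardyNorm ∞ f + T.hardyNorm ∞ g := by
  let G : ℕ → V → ℂ := fun j => if j = 0 then f else if j = 1 then g else 0
  have hG : ∀ j ∉ ({0, 1} : Finset ℕ), G j = 0 := fun j hj => by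
    simp only [Finset.mem_insert, Finset.mem_singleton, not_or] at hj
    simp [G, hj.1, hj.2]
  have h : ∀ x, HasSum (fun j => G j x) ((f + g) x) := fun x => by
    have : HasSum (fun j => G j x) (∑ j ∈ ({0, 1} : Finset ℕ), G j x) :=
      hasSum_sum_of_ne_finset_zero fun j hj => by rw [hG j hj, Pi.zero_apply]
    simpa [G] using this
  refine (T.hardyNorm_le_tsum hm h).trans ((tsum_eq_sum (s := {0, 1}) fun j hj => ?_).le.trans ?_)
  · rw [hG j hj, T.hardyNorm_zero]
  · simp [G]

/-- Divided by `b` times the mass of a Calderón–Zygmund set containing `Q`, the function is an atom;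
passing to that set costs the factor `14`. -/
theorem hardyNorm_le_of_bounded (hm : 2 ≤ m) (T : WeightedTree V m) {Q : Finset V}
    (hQ : Q ∈ T.boxes) (g : V → ℂ) (b : ℝ) (hb : 0 < b) (hg : ∀ x ∉ Q, g x = 0)
    (hgb : ∀ x, ‖g x‖ ≤ b) (hi : ∑ x ∈ Q, (T.weight x : ℂ) * g x = 0) :
    T.hardyNorm ∞ g ≤ ENNReal.ofReal (14 * b * ∑ x ∈ Q, T.weight x) := by
  obtain ⟨R, hR, hQR, hw⟩ := T.exists_czSet_superset hm hQ
  obtain ⟨R', hR', hRR'⟩ := T.exists_mem_boxes_of_mem_czSets hR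
  obtain rfl : R = R' := by exact_mod_cast hRR'
  have hpos := T.sum_weight_pos hm hR'
  set r : ℝ := b * ∑ x ∈ R, T.weight x with hr
  have hr0 : 0 < r := by positivity
  have hr' : (r : ℂ) ≠ 0 := Complex.ofReal_ne_zero.2 hr0.ne'
  have hatom : T.IsAtom ∞ (fun x => (r : ℂ)⁻¹ * g x) := by
    refine (T.isAtom_top_iff hm).2 ⟨R, hR', hR, fun x hx => ?_, ?_, fun x => ?_⟩
    · rw [hg x fun h => hx (hQR h), mul_zero]
    · rw [← Finset.sum_subset hQR fun x _ hx => by rw [hg x hx]; simp]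
      rw [Finset.sum_congr rfl fun x _ => mul_left_comm _ _ _, ← Finset.mul_sum, hi, mul_zero]
    · rw [norm_mul, norm_inv, Complex.norm_real, Real.norm_of_nonneg hr0.le, inv_mul_le_iff₀ hr0,
        hr, mul_inv_cancel_right₀ hpos.ne']
      exact hgb x
  have h := hardyNorm_smul_atom_le hatom r
  simp only [mul_inv_cancel_left₀ hr'] at h
  refine h.trans ?_
  rw [← ofReal_norm, Complex.norm_real, Real.norm_of_nonneg hr0.le]
  refine ENNReal.ofReal_le_ofReal ?_
  nlinarith

/-! ### Equality of the Hardy spaces. -/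

theorem exists_gaugeLe_hardyNorm (hm : 2 ≤ m) (T : WeightedTree V m) {p : ℝ} (hp : 1 < p) :
    ∃ K : ℝ, 0 < K ∧ ∀ Q ∈ T.boxes, GaugeLe T.weight (T.hardyNorm ∞) p K Q :=
  exists_gaugeLe (T.weight_pos hm) (by linarith [(Nat.cast_nonneg m : (0 : ℝ) ≤ m)])
    (by norm_num : (0 : ℝ) < 14) (T.isRegularSplitting_boxes hm) (fun _ hQ => T.sum_weight_pos hm hQ)
    (T.hardyNorm_zero ∞) (T.hardyNorm_add_le hm)
    (fun _ hQ g b hb => T.hardyNorm_le_of_bounded hm hQ g b hb) hp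

theorem hardyNorm_ofReal_le (hm : 2 ≤ m) (T : WeightedTree V m) {p : ℝ} (hp : 0 < p)
    (g : V → ℂ) : T.hardyNorm (ENNReal.ofReal p) g ≤ T.hardyNorm ∞ g :=
  le_iInf fun c => le_iInf fun a => le_iInf fun h =>
    hardyNorm_le (c := c) (a := a) ⟨fun j => (h.1 j).ofReal_of_top hm hp, h.2⟩

/-- The gauge estimate with `s` the inverse mass bounds every `(1,p)`-atom by `K`, and countable
subadditivity sums these bounds. Stated for each decomposition, it also yields finiteness of the
`H^{1,∞}` norm. -/
theorem hardyNorm_top_le (hm : 2 ≤ m) (T : WeightedTree V m) {p K : ℝ} (hp : 1 < p)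
    (hK : ∀ Q ∈ T.boxes, GaugeLe T.weight (T.hardyNorm ∞) p K Q) (g : V → ℂ)
    (c : ℕ → ℂ) (a : ℕ → V → ℂ) (h : T.IsAtomicDecomposition (ENNReal.ofReal p) g c a) :
    T.hardyNorm ∞ g ≤ ENNReal.ofReal K * ∑' j, ‖c j‖ₑ := by
  have hatom : ∀ j, T.hardyNorm ∞ (a j) ≤ ENNReal.ofReal K := by
    intro j
    obtain ⟨Q, hQ, -, ha, hi, hn⟩ := (T.isAtom_ofReal_iff hm (by linarith)).1 (h.1 j)
    have hpos := T.sum_weight_pos hm hQ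
    have := hK Q hQ (a j) _ (inv_pos.2 hpos) ha hi hn
    rwa [inv_mul_cancel_right₀ hpos.ne'] at this
  calc T.hardyNorm ∞ g ≤ ∑' j, T.hardyNorm ∞ (fun x => c j * a j x) :=
        T.hardyNorm_le_tsum hm h.2.2
    _ ≤ ∑' j, ENNReal.ofReal K * ‖c j‖ₑ := ENNReal.tsum_le_tsum fun j => by
        rw [mul_comm]
        exact (T.hardyNorm_smul_le ∞ (c j) (a j)).trans (by gcongr; exact hatom j)
    _ = ENNReal.ofReal K * ∑' j, ‖c j‖ₑ := ENNReal.tsum_mul_left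

theorem hardyNorm_top_le_mul (hm : 2 ≤ m) (T : WeightedTree V m) {p K : ℝ} (hp : 1 < p)
    (hK0 : 0 < K) (hK : ∀ Q ∈ T.boxes, GaugeLe T.weight (T.hardyNorm ∞) p K Q) (g : V → ℂ) :
    T.hardyNorm ∞ g ≤ ENNReal.ofReal K * T.hardyNorm (ENNReal.ofReal p) g :=
  le_mul_hardyNorm (by simpa using hK0) ENNReal.ofReal_ne_top (T.hardyNorm_top_le hm hp hK g)

theorem hardy_ofReal_eq (hm : 2 ≤ m) (T : WeightedTree V m) {p : ℝ} (hp : 1 < p) :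
    T.hardy (ENNReal.ofReal p) = T.hardy ∞ := by
  obtain ⟨K, -, hK⟩ := T.exists_gaugeLe_hardyNorm hm hp
  ext g
  constructor
  · rintro ⟨hg, c, a, h⟩
    have h1 := T.hardyNorm_top_le hm hp hK g c a h
    have h2 : T.hardyNorm ∞ g < ∞ := h1.trans_lt
      (ENNReal.mul_lt_top ENNReal.ofReal_lt_top (tsum_enorm_lt_top_of_decomposition h))
    obtain ⟨c', a', h', -⟩ := exists_decomposition h2
    exact ⟨hg, c', a', h'⟩
  · rintro ⟨hg, c, a, h⟩
    exact ⟨hg, c, a, fun j => (h.1 j).ofReal_of_top hm (by linarith), h.2⟩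

end

end WeightedTree

/-! Truncation of complex numbers. -/

/-- The nearest point of the square `[-k, k] × [-k, k]`. -/
noncomputable def Complex.truncate (k : ℝ) (z : ℂ) : ℂ :=
  ⟨max (-k) (min z.re k), max (-k) (min z.im k)⟩

theorem Complex.norm_truncate_sub_le (k : ℝ) (z z' : ℂ) :
    ‖Complex.truncate k z - Complex.truncate k z'‖ ≤ ‖z - z'‖ := by
  have h : ∀ s t : ℝ, |max (-k) (min s k) - max (-k) (min t k)| ≤ |s - t| := fun s t => by
    simpa [Real.dist_eq] using
      ((LipschitzWith.id.min_const k).const_max (-k)).dist_le_mul s t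
  rw [Complex.norm_def, Complex.norm_def, Complex.normSq_apply, Complex.normSq_apply]
  refine Real.sqrt_le_sqrt (add_le_add ?_ ?_)
  · have := sq_le_sq.2 (h z.re z'.re)
    rw [sq, sq] at this
    exact this
  · have := sq_le_sq.2 (h z.im z'.im)
    rw [sq, sq] at this
    exact this

theorem Complex.norm_truncate_le {k : ℝ} (hk : 0 ≤ k) (z : ℂ) :
    ‖Complex.truncate k z‖ ≤ 2 * k := by
  have h : ∀ t : ℝ, |max (-k) (min t k)| ≤ k := fun t =>
    abs_le.2 ⟨le_max_left _ _, max_le (by linarith) (min_le_right _ _)⟩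
  refine (Complex.norm_le_abs_re_add_abs_im _).trans ?_
  have h1 := h z.re
  have h2 := h z.im
  simp only [Complex.truncate]
  linarith

theorem Complex.tendsto_truncate (z : ℂ) :
    Filter.Tendsto (fun k : ℕ => Complex.truncate k z) Filter.atTop (nhds z) := by
  refine tendsto_const_nhds.congr' ?_
  filter_upwards [Filter.eventually_ge_atTop ⌈‖z‖⌉₊] with k hk
  have h0 : ‖z‖ ≤ k := (Nat.le_ceil _).trans (by exact_mod_cast hk)
  have h1 := abs_le.1 ((Complex.abs_re_le_norm z).trans h0)
  have h2 := abs_le.1 ((Complex.abs_im_le_norm z).trans h0)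
  apply Complex.ext
  · simp [Complex.truncate, min_eq_left h1.2, max_eq_right h1.1]
  · simp [Complex.truncate, min_eq_left h2.2, max_eq_right h2.1]

namespace WeightedTree

noncomputable section

variable {V : Type*} {m : ℕ} [MeasurableSpace V]

/-! Functions of bounded mean oscillation as functionals. -/

theorem osc_le_supOsc (T : WeightedTree V m) (q : ℝ) (f : V → ℂ) {R : Set V} (hR : R ∈ T.czSets) :
    T.osc q f R ≤ T.supOsc q f :=
  le_iSup₂_of_le R hR le_rfl

variable [DiscreteMeasurableSpace V]

/-- A contraction of a function of bounded mean oscillation, integrated against an atom. -/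
theorem enorm_integral_atom_le (hm : 2 ≤ m) (T : WeightedTree V m) {φ : ℂ → ℂ}
    (hφ : ∀ z z', ‖φ z - φ z'‖ ≤ ‖z - z'‖) (f : V → ℂ) {a : V → ℂ} (ha : T.IsAtom ∞ a) :
    ‖∫ x, φ (f x) * a x ∂T.μ‖ₑ ≤ T.supOsc 1 f := by
  obtain ⟨Q, hQ, hR, ha0, hi, hn⟩ := (T.isAtom_top_iff hm).1 ha
  have hpos := T.sum_weight_pos hm hQ
  refine le_trans ?_ (T.osc_le_supOsc 1 f hR)
  rw [T.osc_finset hm hpos one_pos, ← ofReal_norm,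
    T.integral_eq_sum hm (Q := Q) fun x hx => by rw [ha0 x hx, mul_zero]]
  refine ENNReal.ofReal_le_ofReal ?_
  simp only [Real.rpow_one, div_one]
  set c := weightedMean T.weight Q f
  -- The constant subtracted is `φ c`, with `c` the mean of `f`, rather than the mean of `φ ∘ f`;
  -- the contraction then loses no factor.
  have h1 : ∑ x ∈ Q, (T.weight x : ℂ) * (φ (f x) * a x) =
      ∑ x ∈ Q, (T.weight x : ℂ) * ((φ (f x) - φ c) * a x) := by
    have h2 : ∑ x ∈ Q, (T.weight x : ℂ) * (φ c * a x) = 0 := by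
      rw [Finset.sum_congr rfl fun x _ => mul_left_comm _ _ _, ← Finset.mul_sum, hi, mul_zero]
    rw [← sub_zero (∑ x ∈ Q, (T.weight x : ℂ) * (φ (f x) * a x)), ← h2,
      ← Finset.sum_sub_distrib]
    exact Finset.sum_congr rfl fun x _ => by ring
  rw [h1, Finset.sum_div]
  refine (norm_sum_le _ _).trans (Finset.sum_le_sum fun x _ => ?_)
  rw [norm_mul, norm_mul, Complex.norm_real, Real.norm_of_nonneg (T.weight_pos hm x).le,
    mul_div_assoc, div_eq_mul_inv]
  exact mul_le_mul_of_nonneg_left (mul_le_mul (hφ _ _) (hn x) (norm_nonneg _) (norm_nonneg _))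
    (T.weight_pos hm x).le

theorem integrable_of_finset (T : WeightedTree V m) {Q : Finset V} {h : V → ℂ}
    (hh : ∀ x ∉ Q, h x = 0) : Integrable h T.μ :=
  (T.integrableOn_finite Q.finite_toSet h).integrable_of_forall_notMem_eq_zero
    fun x hx => hh x (by simpa using hx)

theorem integral_norm_eq_sum (hm : 2 ≤ m) (T : WeightedTree V m) {Q : Finset V} {f : V → ℂ}
    (hf : ∀ x ∉ Q, f x = 0) : ∫ x, ‖f x‖ ∂T.μ = ∑ x ∈ Q, T.weight x * ‖f x‖ := by
  rw [← setIntegral_eq_integral_of_forall_compl_eq_zero (s := (Q : Set V))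
    fun x hx => by rw [hf x (by simpa using hx), norm_zero],
    MeasureTheory.setIntegral_finset Q (T.integrableOn_finite Q.finite_toSet f).norm]
  refine Finset.sum_congr rfl fun x _ => ?_
  rw [Measure.real, μ_singleton, ENNReal.toReal_ofReal (T.weight_pos hm x).le, smul_eq_mul]

/-- Atoms have `L¹` norm at most one, so for bounded `b` the series of integrals is dominated by `M
* ‖c j‖` and may be integrated termwise. -/
theorem hasSum_integral_of_decomposition (hm : 2 ≤ m) (T : WeightedTree V m) {b : V → ℂ} {M : ℝ}
    (hb : ∀ x, ‖b x‖ ≤ M) {g : V → ℂ} {c : ℕ → ℂ} {a : ℕ → V → ℂ}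
    (h : T.IsAtomicDecomposition ∞ g c a) :
    HasSum (fun j => c j * ∫ x, b x * a j x ∂T.μ) (∫ x, b x * g x ∂T.μ) := by
  have hsupp : ∀ j, ∃ Q : Finset V, (∀ x ∉ Q, a j x = 0) ∧
      ∑ x ∈ Q, T.weight x * ‖a j x‖ ≤ 1 := by
    intro j
    obtain ⟨Q, hQ, -, ha0, -, hn⟩ := (T.isAtom_top_iff hm).1 (h.1 j)
    refine ⟨Q, ha0, ?_⟩
    refine (Finset.sum_le_sum fun x _ => mul_le_mul_of_nonneg_left (hn x)
      (T.weight_pos hm x).le).trans ?_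
    rw [← Finset.sum_mul, mul_inv_cancel₀ (T.sum_weight_pos hm hQ).ne']
  choose Q hQ0 hQ1 using hsupp
  have hF0 : ∀ j, ∀ x ∉ Q j, b x * (c j * a j x) = 0 := fun j x hx => by
    rw [hQ0 j x hx, mul_zero, mul_zero]
  have hs := hasSum_integral_of_summable_integral_norm (μ := T.μ)
    (F := fun j x => b x * (c j * a j x)) (fun j => T.integrable_of_finset (hF0 j)) ?_
  · have h1 : ∀ x, ∑' j, b x * (c j * a j x) = b x * g x := fun x =>
      ((h.2.2 x).mul_left (b x)).tsum_eq
    have h2 : ∀ j, ∫ x, b x * (c j * a j x) ∂T.μ = c j * ∫ x, b x * a j x ∂T.μ := fun j => by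
      rw [← integral_const_mul]
      exact integral_congr_ae (Filter.Eventually.of_forall fun x => mul_left_comm _ _ _)
    simp only [h1, h2] at hs
    exact hs
  · refine Summable.of_nonneg_of_le (fun j => integral_nonneg fun x => norm_nonneg _) (fun j => ?_)
      (h.2.1.mul_left M)
    rw [T.integral_norm_eq_sum hm (hF0 j)]
    have hM : ∀ x ∈ Q j, T.weight x * ‖b x * (c j * a j x)‖ ≤
        M * ‖c j‖ * (T.weight x * ‖a j x‖) := fun x _ => by
      rw [norm_mul, norm_mul]
      have := mul_le_mul_of_nonneg_right (hb x)
        (by have := T.weight_pos hm x; positivity : 0 ≤ T.weight x * (‖c j‖ * ‖a j x‖))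
      linarith
    refine (Finset.sum_le_sum hM).trans ?_
    rw [← Finset.mul_sum]
    obtain ⟨x⟩ := T.isTree.1.nonempty
    have hM0 : 0 ≤ M := (norm_nonneg _).trans (hb x)
    exact mul_le_of_le_one_right (by positivity) (hQ1 j)

theorem enorm_integral_le_tsum (hm : 2 ≤ m) (T : WeightedTree V m) {φ : ℂ → ℂ} {M : ℝ}
    (hφ : ∀ z z', ‖φ z - φ z'‖ ≤ ‖z - z'‖) (hM : ∀ z, ‖φ z‖ ≤ M) (f : V → ℂ) {g : V → ℂ}
    {c : ℕ → ℂ} {a : ℕ → V → ℂ} (h : T.IsAtomicDecomposition ∞ g c a) :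
    ‖∫ x, φ (f x) * g x ∂T.μ‖ₑ ≤ T.supOsc 1 f * ∑' j, ‖c j‖ₑ := by
  rw [← (T.hasSum_integral_of_decomposition hm (fun x => hM (f x)) h).tsum_eq,
    ← ENNReal.tsum_mul_left]
  refine enorm_tsum_le_tsum_enorm.trans (ENNReal.tsum_le_tsum fun j => ?_)
  rw [enorm_mul, mul_comm]
  gcongr
  exact T.enorm_integral_atom_le hm hφ f (h.1 j)

theorem enorm_integral_le_mul_hardyNorm (hm : 2 ≤ m) (T : WeightedTree V m) {φ : ℂ → ℂ} {M : ℝ}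
    (hφ : ∀ z z', ‖φ z - φ z'‖ ≤ ‖z - z'‖) (hM : ∀ z, ‖φ z‖ ≤ M) {f : V → ℂ}
    (hf : T.supOsc 1 f < ∞) {g : V → ℂ} (hg : T.hardyNorm ∞ g < ∞) :
    ‖∫ x, φ (f x) * g x ∂T.μ‖ₑ ≤ T.supOsc 1 f * T.hardyNorm ∞ g := by
  -- A factor `0` cannot be moved inside an infimum that may be `∞`; here any single decomposition
  -- already shows that the integral vanishes.
  by_cases h0 : T.supOsc 1 f = 0
  · obtain ⟨c, a, h, -⟩ := exists_decomposition hg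
    have := T.enorm_integral_le_tsum hm hφ hM f h
    rwa [h0, zero_mul] at this ⊢
  · exact le_mul_hardyNorm h0 hf.ne fun c a h => T.enorm_integral_le_tsum hm hφ hM f h

theorem tendsto_integral_truncate_of_finset (hm : 2 ≤ m) (T : WeightedTree V m) (f : V → ℂ)
    {Q : Finset V} {g : V → ℂ} (hg : ∀ x ∉ Q, g x = 0) :
    Filter.Tendsto (fun k : ℕ => ∫ x, Complex.truncate k (f x) * g x ∂T.μ) Filter.atTop
      (nhds (∫ x, f x * g x ∂T.μ)) := by
  rw [T.integral_eq_sum hm (Q := Q) fun x hx => by rw [hg x hx, mul_zero]]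
  have h : ∀ k : ℕ, ∫ x, Complex.truncate k (f x) * g x ∂T.μ =
      ∑ x ∈ Q, (T.weight x : ℂ) * (Complex.truncate k (f x) * g x) := fun k =>
    T.integral_eq_sum hm fun x hx => by rw [hg x hx, mul_zero]
  simp only [h]
  exact tendsto_finsetSum _ fun x _ =>
    ((Complex.tendsto_truncate (f x)).mul_const (g x)).const_mul _

/-- Dominated convergence in the atomic series, the terms being at most `‖c j‖` times the mean
oscillation of `f`, uniformly in `k`. The truncated integrals do not involve the decomposition, so
neither does the limit. -/
theorem exists_tendsto_integral_truncate (hm : 2 ≤ m) (T : WeightedTree V m) {f : V → ℂ}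
    (hf : T.supOsc 1 f < ∞) {g : V → ℂ} (hg : g ∈ T.hardy ∞) :
    ∃ l, Filter.Tendsto (fun k : ℕ => ∫ x, Complex.truncate k (f x) * g x ∂T.μ) Filter.atTop
      (nhds l) := by
  obtain ⟨-, c, a, h⟩ := hg
  refine ⟨∑' j, c j * ∫ x, f x * a j x ∂T.μ, ?_⟩
  have h1 : ∀ k : ℕ, ∫ x, Complex.truncate k (f x) * g x ∂T.μ =
      ∑' j, c j * ∫ x, Complex.truncate k (f x) * a j x ∂T.μ := fun k =>
    (T.hasSum_integral_of_decomposition hm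
      (fun x => Complex.norm_truncate_le (Nat.cast_nonneg k) (f x)) h).tsum_eq.symm
  simp only [h1]
  refine tendsto_tsum_of_dominated_convergence (h.2.1.mul_right (T.supOsc 1 f).toReal)
    (fun j => ?_) (Filter.Eventually.of_forall fun k j => ?_)
  · obtain ⟨Q, -, -, ha0, -⟩ := (T.isAtom_top_iff hm).1 (h.1 j)
    exact (T.tendsto_integral_truncate_of_finset hm f ha0).const_mul _
  · rw [norm_mul]
    refine mul_le_mul_of_nonneg_left ?_ (norm_nonneg _)
    rw [← toReal_enorm]
    exact ENNReal.toReal_mono hf.ne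
      (T.enorm_integral_atom_le hm (Complex.norm_truncate_sub_le k) f (h.1 j))

theorem enorm_limit_le (hm : 2 ≤ m) (T : WeightedTree V m) {f : V → ℂ}
    (hf : T.supOsc 1 f < ∞) {g : V → ℂ} (hg : T.hardyNorm ∞ g < ∞) {l : ℂ}
    (hl : Filter.Tendsto (fun k : ℕ => ∫ x, Complex.truncate k (f x) * g x ∂T.μ) Filter.atTop
      (nhds l)) : ‖l‖ₑ ≤ T.supOsc 1 f * T.hardyNorm ∞ g :=
  le_of_tendsto hl.enorm (Filter.Eventually.of_forall fun k =>
    T.enorm_integral_le_mul_hardyNorm hm (Complex.norm_truncate_sub_le k)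
      (Complex.norm_truncate_le (Nat.cast_nonneg k)) hf hg)

theorem exists_finset_of_mem_hardyFin (hm : 2 ≤ m) (T : WeightedTree V m) {g : V → ℂ}
    (hg : g ∈ T.hardyFin ∞) : ∃ Q : Finset V, ∀ x ∉ Q, g x = 0 := by
  classical
  induction hg using Submodule.span_induction with
  | mem a ha =>
    obtain ⟨Q, -, -, h, -⟩ := (T.isAtom_top_iff hm).1 ha
    exact ⟨Q, h⟩
  | zero => exact ⟨∅, fun _ _ => rfl⟩
  | add g g' _ _ h h' =>
    obtain ⟨Q, hQ⟩ := h
    obtain ⟨Q', hQ'⟩ := h'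
    refine ⟨Q ∪ Q', fun x hx => ?_⟩
    rw [Finset.mem_union, not_or] at hx
    rw [Pi.add_apply, hQ x hx.1, hQ' x hx.2, add_zero]
  | smul b g _ h =>
    obtain ⟨Q, hQ⟩ := h
    exact ⟨Q, fun x hx => by rw [Pi.smul_apply, hQ x hx, smul_zero]⟩

/-- A function of bounded mean oscillation defines a bounded functional on `H^1(μ)`. -/
theorem exists_represents (hm : 2 ≤ m) (T : WeightedTree V m) {f : V → ℂ}
    (hf : T.supOsc 1 f < ∞) : ∃ L : T.hardy ∞ →ₗ[ℂ] ℂ, T.Represents f (T.supOsc 1 f) L := by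
  have hex := fun g : T.hardy ∞ => T.exists_tendsto_integral_truncate hm hf g.2
  -- The functional is this limit; linearity follows from uniqueness of limits.
  choose l hl using hex
  have hint : ∀ (k : ℕ) (g : T.hardy ∞),
      Integrable (fun x => Complex.truncate k (f x) * (g : V → ℂ) x) T.μ := fun k g =>
    g.2.1.bdd_mul (Measurable.of_discrete).aestronglyMeasurable
      (Filter.Eventually.of_forall fun x =>
        Complex.norm_truncate_le (Nat.cast_nonneg k) (f x))
  let L : T.hardy ∞ →ₗ[ℂ] ℂ :=
    { toFun := l
      map_add' := fun g g' => by
        refine tendsto_nhds_unique (hl (g + g')) (((hl g).add (hl g')).congr fun k => ?_)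
        rw [← integral_add (hint k g) (hint k g')]
        exact integral_congr_ae (Filter.Eventually.of_forall fun x => (mul_add _ _ _).symm)
      map_smul' := fun b g => by
        refine tendsto_nhds_unique (hl (b • g)) (((hl g).const_mul b).congr fun k => ?_)
        rw [← integral_const_mul]
        exact integral_congr_ae (Filter.Eventually.of_forall fun x => mul_left_comm _ _ _) }
  refine ⟨L, fun g hg => ?_, fun g => ?_⟩
  · obtain ⟨Q, hQ⟩ := T.exists_finset_of_mem_hardyFin hm hg
    exact tendsto_nhds_unique (hl g) (T.tendsto_integral_truncate_of_finset hm f hQ)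
  · obtain ⟨-, c, a, h⟩ := g.2
    exact T.enorm_limit_le hm hf
      ((hardyNorm_le h).trans_lt (tsum_enorm_lt_top_of_decomposition h)) (hl g)

/-! Comparison of mean oscillations. -/

theorem supOsc_one_le (hm : 2 ≤ m) (T : WeightedTree V m) {q : ℝ} (hq : 1 ≤ q) (f : V → ℂ) :
    T.supOsc 1 f ≤ T.supOsc q f := by
  refine iSup₂_le fun R hR => ?_
  refine le_trans ?_ (T.osc_le_supOsc q f hR)
  obtain ⟨Q, hQ, rfl⟩ := T.exists_mem_boxes_of_mem_czSets hR
  have hpos := T.sum_weight_pos hm hQ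
  rw [T.osc_finset hm hpos one_pos, T.osc_finset hm hpos (by linarith)]
  refine ENNReal.ofReal_le_ofReal ?_
  have hq0 : 0 < q := by linarith
  set u : V → ℂ := fun x => f x - weightedMean T.weight Q f with hu
  -- Jensen's inequality, applied to `‖u‖` viewed as a complex-valued function.
  have h := norm_weightedMean_rpow_le (fun x => (T.weight_pos hm x).le) hpos hq
    (fun x => ((‖u x‖ : ℝ) : ℂ))
  have h1 : weightedMean T.weight Q (fun x => ((‖u x‖ : ℝ) : ℂ)) =
      (((∑ x ∈ Q, T.weight x * ‖u x‖) / ∑ x ∈ Q, T.weight x : ℝ) : ℂ) := by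
    simp [weightedMean]
  have h0 : 0 ≤ (∑ x ∈ Q, T.weight x * ‖u x‖) / ∑ x ∈ Q, T.weight x :=
    div_nonneg (Finset.sum_nonneg fun x _ => mul_nonneg (T.weight_pos hm x).le (norm_nonneg _))
      hpos.le
  rw [h1] at h
  simp only [Complex.norm_real, norm_norm, Real.norm_of_nonneg h0] at h
  have h2 := Real.rpow_le_rpow (Real.rpow_nonneg h0 q) h (by positivity : 0 ≤ 1 / q)
  rw [← Real.rpow_mul h0, mul_one_div_cancel hq0.ne', Real.rpow_one] at h2
  simpa only [Real.rpow_one, div_one] using h2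

/-- Duality between `L^p` and `L^q` on `Q`. The extremal function for `u = f - f_Q` is tested
against `f`; the pairing gives the integral of `‖u‖ ^ q`, while its Hardy norm is at most `K` times
an `L^p` average of the same quantity. -/
theorem osc_le_of_gaugeLe (hm : 2 ≤ m) (T : WeightedTree V m) {p q K : ℝ}
    (hpq : p.HolderConjugate q) (hK0 : 0 < K) {Q : Finset V} (hQ : Q ∈ T.boxes)
    (hK : GaugeLe T.weight (T.hardyNorm ∞) p K Q) {f : V → ℂ} (hf : T.supOsc 1 f < ∞) :
    T.osc q f Q ≤ ENNReal.ofReal (2 * K) * T.supOsc 1 f := by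
  classical
  have hpos := T.sum_weight_pos hm hQ
  have hp1 : 1 < p := hpq.lt
  have hq1 : 1 < q := hpq.symm.lt
  have hw : ∀ x, 0 ≤ T.weight x := fun x => (T.weight_pos hm x).le
  rw [T.osc_finset hm hpos (by linarith)]
  set W := ∑ x ∈ Q, T.weight x with hW
  set u : V → ℂ := fun x => f x - weightedMean T.weight Q f with hu
  set S := ∑ x ∈ Q, T.weight x * ‖u x‖ ^ q with hS
  have hS0 : 0 ≤ S := T.sum_weight_mul_rpow_nonneg hm Q q u
  -- `S` must be positive both for the gauge parameter and for the final division.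
  rcases hS0.eq_or_lt with hS' | hSpos
  · change ENNReal.ofReal ((S / W) ^ (1 / q)) ≤ _
    rw [← hS', zero_div, Real.zero_rpow (by positivity), ENNReal.ofReal_zero]
    exact bot_le
  set v : V → ℂ := fun x => (starRingEnd ℂ) (u x) * ((‖u x‖ ^ (q - 2) : ℝ) : ℂ) with hv
  have hvnorm : ∀ x, ‖v x‖ ^ p = ‖u x‖ ^ q := by
    intro x
    by_cases hx : u x = 0
    · simp [hv, hx, (by linarith : p ≠ 0), (by linarith : q ≠ 0)]
    · have hx' : 0 < ‖u x‖ := norm_pos_iff.2 hx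
      have h1 : ‖v x‖ = ‖u x‖ ^ (q - 1) := by
        rw [hv, norm_mul, RCLike.norm_conj, Complex.norm_real,
          Real.norm_of_nonneg (Real.rpow_nonneg hx'.le _), mul_comm, ← Real.rpow_add_one hx'.ne']
        congr 1
        ring
      rw [h1, ← Real.rpow_mul hx'.le]
      congr 1
      have := hpq.mul_eq_add
      linarith
  have huv : ∀ x, u x * v x = ((‖u x‖ ^ q : ℝ) : ℂ) := by
    intro x
    by_cases hx : u x = 0
    · simp [hv, hx, (by linarith : q ≠ 0)]
    · have hx' : 0 < ‖u x‖ := norm_pos_iff.2 hx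
      rw [hv, ← mul_assoc, Complex.mul_conj, Complex.normSq_eq_norm_sq, ← Complex.ofReal_mul,
        ← Real.rpow_natCast, ← Real.rpow_add hx']
      congr 2
      push_cast
      ring
  -- Subtracting the mean makes the test function admissible at the price of a factor `2` in `L^p`;
  -- the pairing is unchanged because `u` has mean zero on `Q`.
  set ψ : V → ℂ := (Q : Set V).indicator fun x => v x - weightedMean T.weight Q v with hψ
  have hψ0 : ∀ x ∉ Q, ψ x = 0 := fun x hx => Set.indicator_of_notMem (by simpa using hx) _
  have hψ1 : ∀ x ∈ Q, ψ x = v x - weightedMean T.weight Q v := fun x hx =>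
    Set.indicator_of_mem (by simpa using hx) _
  have hψi : ∑ x ∈ Q, (T.weight x : ℂ) * ψ x = 0 := by
    rw [Finset.sum_congr rfl fun x hx => by rw [hψ1 x hx, mul_sub], Finset.sum_sub_distrib,
      sum_weight_mul_weightedMean hpos, sub_self]
  have hui : ∑ x ∈ Q, (T.weight x : ℂ) * u x = 0 := by
    rw [Finset.sum_congr rfl fun x _ => mul_sub _ _ _, Finset.sum_sub_distrib,
      sum_weight_mul_weightedMean hpos, sub_self]
  have hr : 0 < S / W := div_pos hSpos hpos
  have hN := hK ψ (2 * (S / W) ^ (1 / p)) (by positivity) hψ0 hψi (by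
    rw [Finset.sum_congr rfl fun x hx => by rw [hψ1 x hx]]
    refine (sum_weight_mul_norm_sub_weightedMean_rpow_le hw hpos hp1.le v).trans (le_of_eq ?_)
    simp only [hvnorm]
    rw [Real.mul_rpow two_pos.le (by positivity), ← Real.rpow_mul hr.le,
      one_div_mul_cancel (by linarith), Real.rpow_one, mul_assoc, div_mul_cancel₀ _ hpos.ne'])
  have hfψ : ∫ x, f x * ψ x ∂T.μ = (S : ℂ) := by
    rw [T.integral_eq_sum hm (Q := Q) fun x hx => by rw [hψ0 x hx, mul_zero]]
    have h1 : ∀ x ∈ Q, (T.weight x : ℂ) * (f x * ψ x) = (T.weight x : ℂ) * (u x * v x) -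
        weightedMean T.weight Q v * ((T.weight x : ℂ) * u x) +
        weightedMean T.weight Q f * ((T.weight x : ℂ) * ψ x) := fun x hx => by
      rw [hψ1 x hx, hu]; ring
    rw [Finset.sum_congr rfl h1, Finset.sum_add_distrib, Finset.sum_sub_distrib, ← Finset.mul_sum,
      ← Finset.mul_sum, hui, hψi, mul_zero, mul_zero, sub_zero, add_zero, hS]
    push_cast
    exact Finset.sum_congr rfl fun x _ => by rw [huv]
  have hle := (T.enorm_limit_le hm hf (hN.trans_lt ENNReal.ofReal_lt_top)
    (T.tendsto_integral_truncate_of_finset hm f hψ0)).trans (mul_le_mul_right hN _)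
  obtain ⟨s, hs⟩ : ∃ s : ℝ≥0, T.supOsc 1 f = s := ⟨_, (ENNReal.coe_toNNReal hf.ne).symm⟩
  rw [hfψ, hs, ← ofReal_norm, Complex.norm_real, Real.norm_of_nonneg hS0,
    ← ENNReal.ofReal_coe_nnreal, ← ENNReal.ofReal_mul s.coe_nonneg,
    ENNReal.ofReal_le_ofReal_iff (by positivity)] at hle
  rw [hs, ← ENNReal.ofReal_coe_nnreal, ← ENNReal.ofReal_mul (by positivity)]
  refine ENNReal.ofReal_le_ofReal ?_
  have h1 : (S / W) ^ (1 / q) * (S / W) ^ (1 / p) = S / W := by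
    rw [← Real.rpow_add hr, one_div, one_div, add_comm, hpq.inv_add_inv_eq_one, Real.rpow_one]
  have h2 : S / W ≤ 2 * K * s * (S / W) ^ (1 / p) := by
    rw [div_le_iff₀ hpos]
    linarith
  exact le_of_mul_le_mul_right (h1.trans_le h2) (by positivity)

theorem supOsc_le_of_gaugeLe (hm : 2 ≤ m) (T : WeightedTree V m) {p q K : ℝ}
    (hpq : p.HolderConjugate q) (hK0 : 0 < K)
    (hK : ∀ Q ∈ T.boxes, GaugeLe T.weight (T.hardyNorm ∞) p K Q) (f : V → ℂ) :
    T.supOsc q f ≤ ENNReal.ofReal (2 * K) * T.supOsc 1 f := by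
  rcases eq_or_ne (T.supOsc 1 f) ∞ with h | h
  · rw [h, ENNReal.mul_top (by simpa using hK0)]
    exact le_top
  · refine iSup₂_le fun R hR => ?_
    obtain ⟨Q, hQ, rfl⟩ := T.exists_mem_boxes_of_mem_czSets hR
    exact T.osc_le_of_gaugeLe hm hpq hK0 hQ (hK Q hQ) h.lt_top

theorem memLp_restrict_finite (T : WeightedTree V m) (f : V → ℂ) (p : ℝ≥0∞) {K : Set V}
    (hK : K.Finite) : MemLp f p (T.μ.restrict K) := by
  have : IsFiniteMeasure (T.μ.restrict K) := ⟨by simpa using T.μ_lt_top hK⟩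
  refine MemLp.of_bound (Measurable.of_discrete).aestronglyMeasurable
    (∑ x ∈ hK.toFinset, ‖f x‖) ?_
  refine ae_restrict_of_forall_mem MeasurableSet.of_discrete fun x hx => ?_
  exact Finset.single_le_sum (f := fun x => ‖f x‖) (fun y _ => norm_nonneg _)
    (hK.mem_toFinset.2 hx)

theorem mem_bmoFun_iff (T : WeightedTree V m) {q : ℝ} {f : V → ℂ} :
    f ∈ T.bmoFun q ↔ T.supOsc q f < ∞ :=
  ⟨fun h => h.2, fun h => ⟨fun _ hK => T.memLp_restrict_finite f _ hK, h⟩⟩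

end

end WeightedTree

theorem mainTheorem2 {V : Type*} [MeasurableSpace V] [DiscreteMeasurableSpace V] {m : ℕ}
    (hm : 2 ≤ m) (T : WeightedTree V m) :
    ∃ (A : ℝ) (C : ℝ → ℝ), 0 < A ∧
      (∀ f ∈ T.bmoFun 1, ∃ L : T.hardy ∞ →ₗ[ℂ] ℂ,
        T.Represents f (ENNReal.ofReal A * T.supOsc 1 f) L) ∧
      (∀ p : ℝ, 1 < p → T.hardy (ENNReal.ofReal p) = T.hardy ∞ ∧
        ∀ g ∈ T.hardy ∞, T.hardyNorm (ENNReal.ofReal p) g ≤ T.hardyNorm ∞ g ∧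
          T.hardyNorm ∞ g ≤ ENNReal.ofReal (C p) * T.hardyNorm (ENNReal.ofReal p) g) ∧
      ∀ p q : ℝ, p.HolderConjugate q →
        T.bmo q = T.bmo 1 ∧
        ∀ F ∈ T.bmo q, T.bmoNorm 1 F ≤ T.bmoNorm q F ∧
          T.bmoNorm q F ≤ ENNReal.ofReal (A * C p) * T.bmoNorm 1 F := by
  choose! C hC0 hC using fun p (hp : 1 < p) => T.exists_gaugeLe_hardyNorm hm hp
  -- The value `2` comes from the duality argument; the functional itself satisfies its bound with
  -- constant `1`.
  refine ⟨2, C, two_pos, fun f hf => ?_, fun p hp => ⟨T.hardy_ofReal_eq hm hp, fun g _ =>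
    ⟨T.hardyNorm_ofReal_le hm (by linarith) g,
      T.hardyNorm_top_le_mul hm hp (hC0 p hp) (hC p hp) g⟩⟩, fun p q hpq => ?_⟩
  · obtain ⟨L, hL, hL'⟩ := T.exists_represents hm hf.2
    refine ⟨L, hL, fun g => (hL' g).trans ?_⟩
    gcongr
    exact le_mul_of_one_le_left bot_le (by norm_num)
  · have h1 := T.supOsc_one_le hm hpq.symm.lt.le
    have h2 := T.supOsc_le_of_gaugeLe hm hpq (hC0 p hpq.lt) (hC p hpq.lt)
    have h3 : T.bmoFun q = T.bmoFun 1 := by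
      ext f
      rw [T.mem_bmoFun_iff, T.mem_bmoFun_iff]
      exact ⟨(h1 f).trans_lt, fun h => (h2 f).trans_lt (ENNReal.mul_lt_top ENNReal.ofReal_lt_top h)⟩
    refine ⟨by rw [WeightedTree.bmo, WeightedTree.bmo, h3], ?_⟩
    rintro _ ⟨f, -, rfl⟩
    exact ⟨h1 f, h2 f⟩
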